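/- Let $\alpha<\beta$ be real numbers. For an even integer $p\ge 4$ and $S\subset[p]=\{1,\dots,p\}$ with $|S|=p/2$, write $\bar S=[p]\setminus S$, and $i\sim j$ if $i,j$ lie in the same one of the sets $S,\bar S$. The Ising blockmodel $\mathbb P_S$ is the probability measure on $\{-1,1\}^p$ whose density with respect to the counting measure is proportional to $$\exp\Big[\frac{\beta}{2p}\sum_{i\sim j}\sigma_i\sigma_j+\frac{\alpha}{2p}\sum_{i\nsim j}\sigma_i\sigma_j\Big]$$ (sums over ordered pairs). Let $\Sigma=\mathbb E[\sigma\sigma^\top]$ for $\sigma\sim\mathbb P_S$; let $\Delta$ be the common value of $\Sigma_{ij}$ over $i\ne j$ with $i\sim j$, and $\Omega$ the common value of $\Sigma_{ij}$ over $i\nsim j$. Given $n$ independent observations $\sigma^{(1)},\dots,\sigma^{(n)}\sim\mathbb P_S$, let $\hat\Sigma=\frac1n\sum_{t=1}^n\sigma^{(t)}\sigma^{(t)\top}$ and $\hat\Gamma=P\hat\Sigma P$, where $P=I_p-\frac1p\mathbf 1\mathbf 1^\top$. For $T\subset[p]$ put $v_T=\mathbf 1_T-\mathbf 1_{\bar T}\in\{-1,1\}^p$.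 Consider the semidefinite program $$\max_{V\in\mathcal E}\operatorname{Tr}(\hat\Gamma V),\qquad \mathcal E=\{V\in\mathbb R^{p\times p}: V=V^\top,\ V\succeq 0,\ V_{ii}=1 \text{ for all } i\}.\qquad (\ast)$$ There is a constant $C>0$, depending only on $\alpha$ and $\beta$, such that $\Delta-\Omega>C/p$ for all such $p$ and $S$. Moreover, for every $C>0$ there is a sequence $\varepsilon_p\to0$ as $p\to\infty$, depending only on $\alpha,\beta,C$, such that the following holds for all $p$ and $S$ as above with $\Delta-\Omega>C/p$, all $\delta>0$ and all integers $n\ge 0$: if $$n>16\Big(3+\frac2C\Big)\frac{\log(4p/\delta)}{\Delta-\Omega}\,(1+\varepsilon_p),$$ then with probability at least $1-\delta$ the program $(\ast)$ has the unique maximizer $v_Sv_S^\top$; in particular it recovers the partition exactly: for the maximizer $V$, the sets $T\subset[p]$ with $V=v_Tv_T^\top$ are exactly $S$ and $\bar S$. -/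

import Mathlib

open MeasureTheory Filter Topology

noncomputable section

namespace IsingBlock

/-- Spin configurations `σ ∈ {-1, 1}^p`; the units of `ℤ` are exactly `1` and `-1`. -/
abbrev Config (p : ℕ) : Type := Fin p → ℤˣ

/-- The `i`-th spin of a configuration, as a real number. -/
def spin {p : ℕ} (σ : Config p) (i : Fin p) : ℝ := ((σ i : ℤ) : ℝ)

/-- `i ∼ j`: the sites `i` and `j` are both in `S` or both in the complement of `S`. -/
def SameBlock {p : ℕ} (S : Finset (Fin p)) (i j : Fin p) : Prop := i ∈ S ↔ j ∈ S

instance {p : ℕ} (S : Finset (Fin p)) (i j : Fin p) : Decidable (SameBlock S i j) :=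
  inferInstanceAs (Decidable (i ∈ S ↔ j ∈ S))

/-- The exponent `β/(2p) ∑_{i ∼ j} σ_i σ_j + α/(2p) ∑_{i ≁ j} σ_i σ_j`, the sums being over
ordered pairs of sites. -/
def exponent {p : ℕ} (S : Finset (Fin p)) (α β : ℝ) (σ : Config p) : ℝ :=
  β / (2 * p) * (∑ x : Fin p × Fin p with SameBlock S x.1 x.2, spin σ x.1 * spin σ x.2) +
  α / (2 * p) * (∑ x : Fin p × Fin p with ¬ SameBlock S x.1 x.2, spin σ x.1 * spin σ x.2)

/-- The partition function. -/
def partitionFunction {p : ℕ} (S : Finset (Fin p)) (α β : ℝ) : ℝ :=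
  ∑ σ : Config p, Real.exp (exponent S α β σ)

/-- The density of the Ising blockmodel with respect to the counting measure. -/
def density {p : ℕ} (S : Finset (Fin p)) (α β : ℝ) (σ : Config p) : ℝ :=
  Real.exp (exponent S α β σ) / partitionFunction S α β

/-- The Ising blockmodel, a probability measure on `{-1, 1}^p`. -/
def law {p : ℕ} (S : Finset (Fin p)) (α β : ℝ) : Measure (Config p) :=
  Measure.count.withDensity fun σ => ENNReal.ofReal (density S α β σ)

/-- The law of `n` independent observations from the Ising blockmodel. -/
def sampleLaw {p : ℕ} (S : Finset (Fin p)) (α β : ℝ) (n : ℕ) : Measure (Fin n → Config p) :=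
  Measure.pi fun _ => law S α β

/-- The covariance matrix `Σ = 𝔼[σ σᵀ]`. -/
def covMatrix {p : ℕ} (S : Finset (Fin p)) (α β : ℝ) : Matrix (Fin p) (Fin p) ℝ :=
  Matrix.of fun i j => ∫ σ, spin σ i * spin σ j ∂(law S α β)

/-- The ordered pairs of distinct sites lying in the same block. -/
def withinPairs {p : ℕ} (S : Finset (Fin p)) : Finset (Fin p × Fin p) :=
  {x | x.1 ≠ x.2 ∧ SameBlock S x.1 x.2}

/-- The ordered pairs of sites lying in different blocks. -/
def acrossPairs {p : ℕ} (S : Finset (Fin p)) : Finset (Fin p × Fin p) :=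
  {x | ¬ SameBlock S x.1 x.2}

/-- `Δ`, the common value of `Σ_ij` over `i ≠ j` with `i ∼ j` (see `covMatrix_within`), written
as the average of these entries. -/
def Delta {p : ℕ} (S : Finset (Fin p)) (α β : ℝ) : ℝ :=
  (∑ x ∈ withinPairs S, covMatrix S α β x.1 x.2) / (withinPairs S).card

/-- `Ω`, the common value of `Σ_ij` over `i ≁ j` (see `covMatrix_across`), written as the average
of these entries. -/
def Omega {p : ℕ} (S : Finset (Fin p)) (α β : ℝ) : ℝ :=
  (∑ x ∈ acrossPairs S, covMatrix S α β x.1 x.2) / (acrossPairs S).card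

/-- The empirical covariance matrix `(1/n) ∑_t σ⁽ᵗ⁾ σ⁽ᵗ⁾ᵀ`. -/
def empCov {p n : ℕ} (s : Fin n → Config p) : Matrix (Fin p) (Fin p) ℝ :=
  (1 / (n : ℝ)) • ∑ t, Matrix.vecMulVec (spin (s t)) (spin (s t))

/-- `P = I - (1/p) 1 1ᵀ`, the projector onto the orthogonal complement of the all-ones vector. -/
def centering (p : ℕ) : Matrix (Fin p) (Fin p) ℝ :=
  1 - (1 / (p : ℝ)) • Matrix.vecMulVec (fun _ => 1) (fun _ => 1)

/-- The centered empirical covariance matrix `P Σ̂ P`. -/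
def centeredEmpCov {p n : ℕ} (s : Fin n → Config p) : Matrix (Fin p) (Fin p) ℝ :=
  centering p * empCov s * centering p

/-- The elliptope: real symmetric positive semidefinite matrices with unit diagonal. -/
def elliptope (p : ℕ) : Set (Matrix (Fin p) (Fin p) ℝ) :=
  {V | V.PosSemidef ∧ ∀ i, V i i = 1}

/-- `V` is a solution of the semidefinite program `max Tr(A V)` over the elliptope. -/
def IsSDPSolution {p : ℕ} (A V : Matrix (Fin p) (Fin p) ℝ) : Prop :=
  V ∈ elliptope p ∧ ∀ W ∈ elliptope p, (A * W).trace ≤ (A * V).trace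

/-- `v_S = 1_S - 1_{Sᶜ}`. -/
def blockVec {p : ℕ} (S : Finset (Fin p)) : Fin p → ℝ := fun i => if i ∈ S then 1 else -1

/-- `v_S v_Sᵀ`. -/
def blockMatrix {p : ℕ} (S : Finset (Fin p)) : Matrix (Fin p) (Fin p) ℝ :=
  Matrix.vecMulVec (blockVec S) (blockVec S)

/-- The unordered partition that can be read off from `V` is exactly `{S, Sᶜ}`: the sets `T` with
`V = v_T v_Tᵀ` are `S` and `Sᶜ`. -/
def RecoversBlocks {p : ℕ} (V : Matrix (Fin p) (Fin p) ℝ) (S : Finset (Fin p)) : Prop :=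
  ∀ T : Finset (Fin p), V = blockMatrix T ↔ T = S ∨ T = Sᶜ

instance : DiscreteMeasurableSpace ℤˣ :=
  ⟨fun s => ⟨Units.val '' s, .of_discrete, Set.preimage_image_eq s Units.val_injective⟩⟩

theorem partitionFunction_pos {p : ℕ} (S : Finset (Fin p)) (α β : ℝ) :
    0 < partitionFunction S α β :=
  Finset.sum_pos (fun _ _ => Real.exp_pos _) Finset.univ_nonempty

theorem density_pos {p : ℕ} (S : Finset (Fin p)) (α β : ℝ) (σ : Config p) :
    0 < density S α β σ :=
  div_pos (Real.exp_pos _) (partitionFunction_pos S α β)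

theorem sum_density {p : ℕ} (S : Finset (Fin p)) (α β : ℝ) :
    ∑ σ : Config p, density S α β σ = 1 := by
  simp only [density, ← Finset.sum_div]
  exact div_self (partitionFunction_pos S α β).ne'

instance {p : ℕ} (S : Finset (Fin p)) (α β : ℝ) : IsProbabilityMeasure (law S α β) := by
  refine ⟨?_⟩
  rw [law, withDensity_apply _ MeasurableSet.univ, Measure.restrict_univ, lintegral_count,
    tsum_fintype, ← ENNReal.ofReal_sum_of_nonneg fun σ _ => (density_pos S α β σ).le,
    sum_density, ENNReal.ofReal_one]

theorem integral_law {p : ℕ} (S : Finset (Fin p)) (α β : ℝ) (F : Config p → ℝ) :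
    ∫ σ, F σ ∂(law S α β) = ∑ σ, density S α β σ * F σ := by
  rw [law, integral_withDensity_eq_integral_toReal_smul₀ (by fun_prop) (by simp),
    integral_fintype (.of_finite)]
  refine Finset.sum_congr rfl fun σ _ => ?_
  simp [Measure.real, (density_pos S α β σ).le]

theorem covMatrix_comm {p : ℕ} (S : Finset (Fin p)) (α β : ℝ) (i j : Fin p) :
    covMatrix S α β i j = covMatrix S α β j i := by
  simp only [covMatrix, Matrix.of_apply, mul_comm]

/-- The covariance is invariant under relabellings of the sites that preserve `∼`. -/
theorem covMatrix_perm {p : ℕ} (S : Finset (Fin p)) (α β : ℝ) (e : Equiv.Perm (Fin p))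
    (he : ∀ i j, SameBlock S (e i) (e j) ↔ SameBlock S i j) (i j : Fin p) :
    covMatrix S α β (e i) (e j) = covMatrix S α β i j := by
  simp only [covMatrix, Matrix.of_apply, integral_law]
  refine Fintype.sum_equiv (e.symm.arrowCongr (Equiv.refl _)) _ _ fun σ => ?_
  have hs : ∀ k, spin ((e.symm.arrowCongr (Equiv.refl _)) σ) k = spin σ (e k) := fun k => rfl
  have hexp : exponent S α β ((e.symm.arrowCongr (Equiv.refl _)) σ) = exponent S α β σ := by
    simp only [exponent, hs, Finset.sum_filter]
    congr 2
    all_goals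
      refine Fintype.sum_equiv (e.prodCongr e) _ _ fun x => ?_
      simp [he]
  simp only [density, hexp, hs]

theorem sameBlock_swap {p : ℕ} (S : Finset (Fin p)) {a b : Fin p} (hab : SameBlock S a b)
    (k : Fin p) : Equiv.swap a b k ∈ S ↔ k ∈ S := by
  unfold SameBlock at hab
  rw [Equiv.swap_apply_def]
  split_ifs with h1 h2
  · rw [h1]; exact hab.symm
  · rw [h2]; exact hab
  · rfl

theorem covMatrix_swap {p : ℕ} (S : Finset (Fin p)) (α β : ℝ) {a b : Fin p}
    (hab : SameBlock S a b) (i j : Fin p) :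
    covMatrix S α β (Equiv.swap a b i) (Equiv.swap a b j) = covMatrix S α β i j :=
  covMatrix_perm S α β _ (fun i j => by simp only [SameBlock, sameBlock_swap S hab]) i j

theorem exists_exchange {p : ℕ} (S : Finset (Fin p)) (hS : 2 * S.card = p) :
    ∃ e : Equiv.Perm (Fin p), ∀ i, e i ∈ S ↔ i ∉ S := by
  have hc : Fintype.card {i // i ∈ S} = Fintype.card {i // ¬ i ∈ S} := by
    rw [Fintype.card_subtype_compl, Fintype.card_coe, Fintype.card_fin]; omega
  let f := Fintype.equivOfCardEq hc
  refine ⟨(Equiv.sumCompl (· ∈ S)).symm.trans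
    ((f.sumCongr f.symm).trans ((Equiv.sumComm _ _).trans (Equiv.sumCompl (· ∈ S)))), fun i => ?_⟩
  by_cases h : i ∈ S
  · simpa [Equiv.sumCompl_symm_apply_of_pos, h] using (f ⟨i, h⟩).2
  · simp [Equiv.sumCompl_symm_apply_of_neg, h]

theorem covMatrix_within_const {p : ℕ} (S : Finset (Fin p)) (hS : 2 * S.card = p) (α β : ℝ)
    {i j k l : Fin p} (hij : i ≠ j) (hij' : SameBlock S i j) (hkl : k ≠ l)
    (hkl' : SameBlock S k l) : covMatrix S α β i j = covMatrix S α β k l := by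
  have key : ∀ i j : Fin p, i ≠ j → SameBlock S i j → SameBlock S i k →
      covMatrix S α β i j = covMatrix S α β k l := by
    intro i j hij hij' hik
    rw [← covMatrix_swap S α β hik i j, Equiv.swap_apply_left]
    have hm := sameBlock_swap S hik j
    have hne : Equiv.swap i k j ≠ k := fun h => hij ((Equiv.swap i k).injective
      (by rw [h, Equiv.swap_apply_left]))
    have hjl : SameBlock S (Equiv.swap i k j) l := by unfold SameBlock at *; tauto
    rw [← covMatrix_swap S α β hjl k, Equiv.swap_apply_left,
      Equiv.swap_apply_of_ne_of_ne hne.symm hkl]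
  by_cases hik : SameBlock S i k
  · exact key i j hij hij' hik
  · obtain ⟨e, he⟩ := exists_exchange S hS
    rw [← covMatrix_perm S α β e (fun i j => by simp only [SameBlock, he, not_iff_not]) i j]
    refine key _ _ (fun h => hij (e.injective h)) ?_ ?_
    · unfold SameBlock at *; rw [he, he]; tauto
    · unfold SameBlock at *; rw [he]; tauto

theorem covMatrix_across_const {p : ℕ} (S : Finset (Fin p)) (α β : ℝ)
    {i j k l : Fin p} (hij : ¬ SameBlock S i j) (hkl : ¬ SameBlock S k l) :
    covMatrix S α β i j = covMatrix S α β k l := by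
  have key : ∀ i j : Fin p, ¬ SameBlock S i j → SameBlock S i k →
      covMatrix S α β i j = covMatrix S α β k l := by
    intro i j hij hik
    rw [← covMatrix_swap S α β hik i j, Equiv.swap_apply_left]
    have hm := sameBlock_swap S hik j
    have hjl : SameBlock S (Equiv.swap i k j) l := by unfold SameBlock at *; tauto
    have h1 : k ≠ Equiv.swap i k j := fun h => by unfold SameBlock at *; rw [← h] at hm; tauto
    have h2 : k ≠ l := fun h => hkl (by rw [h]; exact Iff.rfl)
    rw [← covMatrix_swap S α β hjl k, Equiv.swap_apply_left, Equiv.swap_apply_of_ne_of_ne h1 h2]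
  by_cases hik : SameBlock S i k
  · exact key i j hij hik
  · rw [covMatrix_comm S α β i j]
    exact key j i (by unfold SameBlock at *; tauto) (by unfold SameBlock at *; tauto)

/-- All entries of `Σ` at distinct sites of a common block equal `Δ`. -/
theorem covMatrix_within {p : ℕ} (S : Finset (Fin p)) (hS : 2 * S.card = p) (α β : ℝ)
    {i j : Fin p} (hij : i ≠ j) (hij' : SameBlock S i j) :
    covMatrix S α β i j = Delta S α β := by
  have hmem : (i, j) ∈ withinPairs S := by simp [withinPairs, hij, hij']
  have hpos : 0 < (withinPairs S).card := Finset.card_pos.2 ⟨_, hmem⟩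
  rw [Delta, Finset.sum_congr rfl fun x hx => ?_, Finset.sum_const, nsmul_eq_mul,
    mul_div_cancel_left₀ (covMatrix S α β i j) (by positivity)]
  simp only [withinPairs, Finset.mem_filter, Finset.mem_univ, true_and] at hx
  exact covMatrix_within_const S hS α β hx.1 hx.2 hij hij'

/-- All entries of `Σ` at sites of different blocks equal `Ω`. -/
theorem covMatrix_across {p : ℕ} (S : Finset (Fin p)) (α β : ℝ)
    {i j : Fin p} (hij : ¬ SameBlock S i j) :
    covMatrix S α β i j = Omega S α β := by
  have hmem : (i, j) ∈ acrossPairs S := by simp [acrossPairs, hij]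
  have hpos : 0 < (acrossPairs S).card := Finset.card_pos.2 ⟨_, hmem⟩
  rw [Omega, Finset.sum_congr rfl fun x hx => ?_, Finset.sum_const, nsmul_eq_mul,
    mul_div_cancel_left₀ (covMatrix S α β i j) (by positivity)]
  simp only [acrossPairs, Finset.mem_filter, Finset.mem_univ, true_and] at hx
  exact covMatrix_across_const S α β hx hij

end IsingBlock

end

/-!
The matrix `v vᵀ`, with `v = v_S`, is the unique solution of the semidefinite program as soon as the
matrix `diag(v_i (Γ̂ v)_i) - Γ̂`, which annihilates `v`, is positive definite on the orthogonal
complement of `v` (`unique_isSDPSolution_blockMatrix`). Since `Γ̂` is an average of rank-one terms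
`w wᵀ`, with `w = P σ`, this follows from two estimates: the diagonal entries
`(1/n) ∑_t v_i w_i (v ⬝ σ)` are large, and the quadratic form of `(1/n) ∑_t y yᵀ` is small, where
`y` is the projection of `σ` onto the orthogonal complement of `𝟏` and `v`
(`exact_recovery_of_lt`). As `Σ = (1 - Δ) I + ((Δ + Ω) / 2) 𝟏𝟏ᵀ + ((Δ - Ω) / 2) v vᵀ`
(`covMatrix_apply_eq`), the expectations are `1 - Δ + g` and at most `1 - Δ`, where
`g = p (Δ - Ω) / 2`, so that each average may deviate from its expectation by `g / 2`.

Both deviations are controlled by Bernstein inequalities with bound `p`. For the diagonal entries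
the second moment is at most `p (1 - Δ + g)` by exchangeability (`mean_diagStat_sq_le`), and the
scalar inequality applies. For the matrix average, the Golden–Thompson inequality
(`Matrix.trace_exp_add_le`) lets the trace of the moment generating function factorize over the
observations; it is proved from the Lie–Trotter formula and the inequality
`Tr (A B) ^ (2 ^ j) ≤ Tr A ^ (2 ^ j) B ^ (2 ^ j)`. The sample size needed is then
`8 p (1 - Δ + 7 g / 6) log (4 p / δ) / g ^ 2`. Since `1 - Δ ≤ 1 + 2 / (p - 2)`, and since
`Δ - Ω > C / p` gives `1 / g < 2 / C`, the sample size assumed suffices with `ε_p = 2 / (p - 2)`.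

That `Δ - Ω` is at least of order `1 / p` (`Delta_sub_Omega_ge`) is seen by exchanging the spins at
`i ∈ S` and `j ∉ S`. This reverses the sign of `X = (σ_i - σ_j) ∑_{k ≠ i, j} v_k σ_k` and multiplies
the density by `exp (-(β - α) X / p)`, so `2 𝔼 X = 𝔼 X (1 - exp (-(β - α) X / p))`, which is at
least a constant times `𝔼 X ^ 2 / p`. Here `𝔼 X = (p - 2) (Δ - Ω)`, and `𝔼 X ^ 2` is at least of
order `p` because a single spin flip changes the density by a bounded factor only.
-/

/-! ### The Golden–Thompson inequality -/

namespace Matrix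

/-- The Cauchy–Schwarz inequality for the Frobenius inner product, in additive form. -/
theorem two_mul_trace_mul_transpose_le {ι : Type*} [Fintype ι] (A B : Matrix ι ι ℝ) :
    2 * (A * Bᵀ).trace ≤ (A * Aᵀ).trace + (B * Bᵀ).trace := by
  simp only [trace, diag_apply, mul_apply, transpose_apply, Finset.mul_sum,
    ← Finset.sum_add_distrib]
  exact Finset.sum_le_sum fun i _ => Finset.sum_le_sum fun j _ => by
    nlinarith [sq_nonneg (A i j - B i j)]

variable {ι : Type*} [Fintype ι] [DecidableEq ι]

theorem trace_mul_pow_comm (A B : Matrix ι ι ℝ) (n : ℕ) :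
    ((A * B) ^ n).trace = ((B * A) ^ n).trace := by
  cases n with
  | zero => simp
  | succ n =>
    have h : ∀ k, (A * B) ^ k * A = A * (B * A) ^ k := by
      intro k
      induction k with
      | zero => simp
      | succ k ih => rw [pow_succ', mul_assoc, ih, pow_succ']; simp only [mul_assoc]
    rw [pow_succ, ← mul_assoc, h, mul_assoc, trace_mul_comm, mul_assoc, ← pow_succ]

theorem trace_sq_le_trace_mul_transpose (X : Matrix ι ι ℝ) :
    (X ^ 2).trace ≤ (X * Xᵀ).trace := by
  have h := two_mul_trace_mul_transpose_le X Xᵀ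
  rw [transpose_transpose, trace_mul_comm Xᵀ X] at h
  rw [sq]; linarith

/-- The two inequalities are proved in a joint induction: the first at level `j + 1` is the second
at level `j` applied to `X = A * B`, and the second at level `j + 1` is the second at level `j`
applied to `X ^ 2` followed by the first for the symmetric matrices `Xᵀ * X` and `X * Xᵀ`. -/
theorem trace_pow_two_pow_le (j : ℕ) :
    (∀ A B : Matrix ι ι ℝ, A.IsSymm → B.IsSymm →
      ((A * B) ^ 2 ^ j).trace ≤ (A ^ 2 ^ j * B ^ 2 ^ j).trace) ∧
    ∀ X : Matrix ι ι ℝ, (X ^ 2 ^ (j + 1)).trace ≤ ((X * Xᵀ) ^ 2 ^ j).trace := by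
  induction j with
  | zero =>
    refine ⟨fun A B _ _ => by simp, fun X => ?_⟩
    simpa using trace_sq_le_trace_mul_transpose X
  | succ j ih =>
    obtain ⟨ihP, ihQ⟩ := ih
    refine ⟨fun A B hA hB => ?_, fun X => ?_⟩
    · refine (ihQ (A * B)).trans ?_
      have h1 : A * B * (A * B)ᵀ = A * (B * B * A) := by
        rw [transpose_mul, hA.eq, hB.eq]; simp only [mul_assoc]
      have h2 : B * B * A * A = (B * B) * (A * A) := by simp only [mul_assoc]
      rw [h1, trace_mul_pow_comm, h2, trace_mul_pow_comm]
      have h3 := ihP (A * A) (B * B) (by rw [IsSymm, transpose_mul, hA.eq])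
        (by rw [IsSymm, transpose_mul, hB.eq])
      rwa [← sq A, ← sq B, ← pow_mul, ← pow_mul, ← pow_succ', sq A, sq B] at h3
    · have e1 : (X ^ 2 ^ (j + 1 + 1)) = (X ^ 2) ^ 2 ^ (j + 1) := by rw [← pow_mul, ← pow_succ']
      rw [e1]
      refine (ihQ (X ^ 2)).trans ?_
      have e2 : X ^ 2 * (X ^ 2)ᵀ = X * (X * Xᵀ * Xᵀ) := by
        rw [sq, transpose_mul]; simp only [mul_assoc]
      have e3 : X * Xᵀ * Xᵀ * X = (X * Xᵀ) * (Xᵀ * X) := by simp only [mul_assoc]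
      rw [e2, trace_mul_pow_comm, e3]
      have hs1 : (X * Xᵀ).IsSymm := by rw [IsSymm, transpose_mul, transpose_transpose]
      have hs2 : (Xᵀ * X).IsSymm := by rw [IsSymm, transpose_mul, transpose_transpose]
      refine (ihP _ _ hs1 hs2).trans ?_
      have h4 := two_mul_trace_mul_transpose_le ((X * Xᵀ) ^ 2 ^ j) ((Xᵀ * X) ^ 2 ^ j)
      rw [(hs1.pow _).eq, (hs2.pow _).eq, ← pow_add, ← pow_add, trace_mul_pow_comm Xᵀ X,
        ← two_mul (2 ^ j : ℕ), ← pow_succ' 2 j] at h4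
      linarith

end Matrix

section LieTrotter

variable {𝔸 : Type*} [NormedRing 𝔸] [NormOneClass 𝔸]

theorem norm_pow_sub_pow_le_of_norm_le {x y : 𝔸} {M : ℝ} (hx : ‖x‖ ≤ M) (hy : ‖y‖ ≤ M) (hM : 1 ≤ M)
    (n : ℕ) : ‖x ^ n - y ^ n‖ ≤ n * M ^ n * ‖x - y‖ := by
  induction n with
  | zero => simp
  | succ n ih =>
    have h : x ^ (n + 1) - y ^ (n + 1) = x ^ n * (x - y) + (x ^ n - y ^ n) * y := by
      rw [pow_succ, pow_succ]; noncomm_ring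
    have h1 : ‖x ^ n‖ ≤ M ^ n := (norm_pow_le x n).trans (by gcongr)
    have h0 : 0 ≤ M := by linarith
    have h2 : M ^ n ≤ M ^ (n + 1) := pow_le_pow_right₀ hM (Nat.le_succ n)
    calc ‖x ^ (n + 1) - y ^ (n + 1)‖ ≤ ‖x ^ n‖ * ‖x - y‖ + ‖x ^ n - y ^ n‖ * ‖y‖ := by
          rw [h]; exact (norm_add_le _ _).trans (add_le_add (norm_mul_le _ _) (norm_mul_le _ _))
      _ ≤ M ^ (n + 1) * ‖x - y‖ + (n * M ^ n * ‖x - y‖) * M := by gcongr; exact h1.trans h2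
      _ = ((n + 1 : ℕ) : ℝ) * M ^ (n + 1) * ‖x - y‖ := by push_cast; ring

variable [NormedAlgebra ℝ 𝔸]

theorem NormedSpace.norm_exp_le_exp_norm (x : 𝔸) : ‖NormedSpace.exp x‖ ≤ Real.exp ‖x‖ := by
  rw [Real.exp_eq_exp_ℝ, NormedSpace.exp_eq_tsum ℝ, NormedSpace.exp_eq_tsum ℝ]
  refine tsum_of_norm_bounded (NormedSpace.expSeries_summable' (𝕂 := ℝ) ‖x‖).hasSum fun n => ?_
  rw [norm_smul, smul_eq_mul, norm_inv, RCLike.norm_natCast]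
  gcongr
  exact norm_pow_le _ _

variable [CompleteSpace 𝔸]

/-- The **Lie–Trotter product formula**. -/
theorem NormedSpace.tendsto_exp_mul_exp_pow (a b : 𝔸) :
    Tendsto (fun n : ℕ => (NormedSpace.exp ((n : ℝ)⁻¹ • a) * NormedSpace.exp ((n : ℝ)⁻¹ • b)) ^ n)
      atTop (𝓝 (NormedSpace.exp (a + b))) := by
  have hd : ∀ x : 𝔸, HasDerivAt (fun t : ℝ => NormedSpace.exp (t • x)) x 0 := fun x => by
    simpa using hasDerivAt_exp_smul_const (𝕂 := ℝ) x (0 : ℝ)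
  have hf : HasDerivAt (fun t : ℝ => NormedSpace.exp (t • a) * NormedSpace.exp (t • b) -
      NormedSpace.exp (t • (a + b))) 0 0 := by
    have := ((hd a).fun_mul (hd b)).fun_sub (hd (a + b))
    simpa using this
  set f : ℝ → 𝔸 := fun t => NormedSpace.exp (t • a) * NormedSpace.exp (t • b) -
      NormedSpace.exp (t • (a + b)) with hfdef
  have hslope : Tendsto (fun n : ℕ => ‖(n : ℝ) • f ((n : ℝ)⁻¹)‖) atTop (𝓝 0) := by
    have h1 := hf.tendsto_slope
    have h2 : Tendsto (fun n : ℕ => ((n : ℝ))⁻¹) atTop (𝓝[≠] 0) := by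
      refine tendsto_nhdsWithin_iff.2 ⟨tendsto_inv_atTop_zero.comp tendsto_natCast_atTop_atTop, ?_⟩
      filter_upwards [eventually_gt_atTop 0] with n hn
      simpa using hn.ne'
    have h3 := (h1.comp h2).norm
    rw [norm_zero] at h3
    refine h3.congr fun n => ?_
    simp [slope_def_module, hfdef]
  set K := Real.exp (‖a‖ + ‖b‖)
  have hbound : ∀ᶠ n : ℕ in atTop, ‖(NormedSpace.exp ((n : ℝ)⁻¹ • a) *
      NormedSpace.exp ((n : ℝ)⁻¹ • b)) ^ n - NormedSpace.exp (a + b)‖ ≤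
      K * ‖(n : ℝ) • f ((n : ℝ)⁻¹)‖ := by
    filter_upwards [eventually_gt_atTop 0] with n hn
    have hn' : (0 : ℝ) < n := by exact_mod_cast hn
    set M := Real.exp ((n : ℝ)⁻¹ * (‖a‖ + ‖b‖)) with hM
    have hMn : M ^ n = K := by
      rw [hM, ← Real.exp_nat_mul, ← mul_assoc, mul_inv_cancel₀ hn'.ne', one_mul]
    have hexp : NormedSpace.exp (a + b) = NormedSpace.exp ((n : ℝ)⁻¹ • (a + b)) ^ n := by
      let _ : NormedAlgebra ℚ 𝔸 := NormedAlgebra.restrictScalars ℚ ℝ 𝔸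
      rw [← NormedSpace.exp_nsmul, ← Nat.cast_smul_eq_nsmul ℝ, smul_smul, mul_inv_cancel₀ hn'.ne',
        one_smul]
    have hx : ‖NormedSpace.exp ((n : ℝ)⁻¹ • a) * NormedSpace.exp ((n : ℝ)⁻¹ • b)‖ ≤ M := by
      refine (norm_mul_le _ _).trans ?_
      rw [hM, mul_add, Real.exp_add]
      gcongr
      all_goals
        refine (NormedSpace.norm_exp_le_exp_norm _).trans (le_of_eq ?_)
        rw [norm_smul, norm_inv, RCLike.norm_natCast]
    have hy : ‖NormedSpace.exp ((n : ℝ)⁻¹ • (a + b))‖ ≤ M := by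
      refine (NormedSpace.norm_exp_le_exp_norm _).trans ?_
      rw [norm_smul, norm_inv, RCLike.norm_natCast, hM]
      gcongr
      exact norm_add_le _ _
    rw [hexp]
    refine (norm_pow_sub_pow_le_of_norm_le hx hy (Real.one_le_exp (by positivity)) n).trans ?_
    rw [hMn, norm_smul, RCLike.norm_natCast]
    exact le_of_eq (by ring)
  rw [tendsto_iff_norm_sub_tendsto_zero]
  refine squeeze_zero' (Eventually.of_forall fun _ => norm_nonneg _) hbound ?_
  simpa using hslope.const_mul K

end LieTrotter

namespace Matrix

variable {ι : Type*} [Fintype ι] [DecidableEq ι]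

/-- The **Golden–Thompson inequality** for real symmetric matrices. -/
theorem trace_exp_add_le {A B : Matrix ι ι ℝ} (hA : A.IsSymm) (hB : B.IsSymm) :
    (NormedSpace.exp (A + B)).trace ≤ (NormedSpace.exp A * NormedSpace.exp B).trace := by
  cases isEmpty_or_nonempty ι
  · simp [trace]
  let _ : NormedRing (Matrix ι ι ℝ) := Matrix.linftyOpNormedRing
  let _ : NormedAlgebra ℝ (Matrix ι ι ℝ) := Matrix.linftyOpNormedAlgebra
  have _ : NormOneClass (Matrix ι ι ℝ) := Matrix.linfty_opNormOneClass
  have h1 := (NormedSpace.tendsto_exp_mul_exp_pow A B).comp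
    (tendsto_pow_atTop_atTop_of_one_lt (one_lt_two : (1 : ℕ) < 2))
  have h2 := ((continuous_id.matrix_trace (n := ι) (R := ℝ)).tendsto _).comp h1
  refine le_of_tendsto h2 (Eventually.of_forall fun j => ?_)
  have hpow : ∀ X : Matrix ι ι ℝ,
      NormedSpace.exp (((2 ^ j : ℕ) : ℝ)⁻¹ • X) ^ 2 ^ j = NormedSpace.exp X := fun X => by
    rw [← Matrix.exp_nsmul, ← Nat.cast_smul_eq_nsmul ℝ, smul_smul, mul_inv_cancel₀ (by positivity),
      one_smul]
  have h3 := (trace_pow_two_pow_le j).1 _ _ (hA.smul (((2 ^ j : ℕ) : ℝ)⁻¹)).exp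
    (hB.smul (((2 ^ j : ℕ) : ℝ)⁻¹)).exp
  rw [hpow, hpow] at h3
  exact h3

end Matrix

/-! ### Identities and bounds for the exponential -/

namespace Real

/-- The tail of the exponential series after the linear term, dominated by a geometric series. -/
theorem exp_sub_one_sub_le {u : ℝ} (hu : 0 ≤ u) (hu3 : u < 3) :
    exp u - 1 - u ≤ u ^ 2 / 2 / (1 - u / 3) := by
  have h1 : HasSum (fun n : ℕ => u ^ n / (n.factorial : ℝ)) (exp u) := by
    rw [exp_eq_exp_ℝ]; exact NormedSpace.expSeries_div_hasSum_exp u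
  have h2 := (hasSum_nat_add_iff' 2).2 h1
  have h3 := (hasSum_geometric_of_lt_one (r := u / 3) (by positivity) (by linarith)).mul_left
    (u ^ 2 / 2)
  have h4 := hasSum_le (fun n => ?_) h2 h3
  · simp only [Finset.sum_range_succ, Finset.sum_range_zero, pow_zero, pow_one,
      Nat.factorial] at h4
    rw [div_eq_mul_inv (u ^ 2 / 2)]
    norm_num at h4
    linarith
  · have hf : (2 : ℝ) * 3 ^ n ≤ ((n + 2).factorial : ℝ) := by
      have := Nat.factorial_mul_pow_le_factorial (m := 2) (n := n)
      rw [add_comm 2 n] at this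
      exact_mod_cast this
    calc u ^ (n + 2) / ((n + 2).factorial : ℝ) ≤ u ^ (n + 2) / (2 * 3 ^ n) := by gcongr
      _ = u ^ 2 / 2 * (u / 3) ^ n := by rw [div_pow]; field_simp; ring

theorem exp_le_quadratic_of_nonpos {x : ℝ} (hx : x ≤ 0) : exp x ≤ 1 + x + x ^ 2 / 2 := by
  have h := quadratic_le_exp_of_nonneg (x := -x) (by linarith)
  have h1 : exp x * exp (-x) = 1 := by rw [← exp_add]; simp
  have h0 := exp_pos x
  have h2 : exp x * (1 + -x + (-x) ^ 2 / 2) ≤ exp x * exp (-x) := by gcongr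
  have h3 : 0 < 1 + -x + (-x) ^ 2 / 2 := by nlinarith [sq_nonneg x]
  have h4 : 1 ≤ (1 + x + x ^ 2 / 2) * (1 + -x + (-x) ^ 2 / 2) := by nlinarith [sq_nonneg (x ^ 2)]
  exact le_of_mul_le_mul_right ((h2.trans h1.le).trans h4) h3

/-- The function `(exp x - 1 - x) / x ^ 2` is at most its value at `u` on `(-∞, u]`. -/
theorem exp_sub_one_sub_mul_sq_le {x u : ℝ} (hu : 0 < u) (hx : x ≤ u) :
    (exp x - 1 - x) * u ^ 2 ≤ (exp u - 1 - u) * x ^ 2 := by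
  rcases le_total x 0 with h | h
  · have h1 := exp_le_quadratic_of_nonpos h
    have h2 := quadratic_le_exp_of_nonneg hu.le
    nlinarith [sq_nonneg x, sq_nonneg u, mul_nonneg (sub_nonneg.2 h1) (sq_nonneg u),
      mul_nonneg (sub_nonneg.2 h2) (sq_nonneg x)]
  · have h1 : ∀ z : ℝ, HasSum (fun n : ℕ => z ^ (n + 2) / ((n + 2).factorial : ℝ))
        (exp z - 1 - z) := fun z => by
      have h1 : HasSum (fun n : ℕ => z ^ n / (n.factorial : ℝ)) (exp z) := by
        rw [exp_eq_exp_ℝ]; exact NormedSpace.expSeries_div_hasSum_exp z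
      have h2 := (hasSum_nat_add_iff' 2).2 h1
      simpa [Finset.sum_range_succ, sub_sub] using h2
    refine hasSum_le (fun n => ?_) ((h1 x).mul_right (u ^ 2)) ((h1 u).mul_right (x ^ 2))
    have : x ^ n ≤ u ^ n := by gcongr
    calc x ^ (n + 2) / ((n + 2).factorial : ℝ) * u ^ 2
        = x ^ n * (x ^ 2 * u ^ 2 / ((n + 2).factorial : ℝ)) := by ring
      _ ≤ u ^ n * (x ^ 2 * u ^ 2 / ((n + 2).factorial : ℝ)) := by gcongr
      _ = u ^ (n + 2) / ((n + 2).factorial : ℝ) * x ^ 2 := by ring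

theorem exp_sub_one_mul_le {x u : ℝ} (hx : 0 ≤ x) (hxu : x ≤ u) (hu : 0 < u) :
    (exp x - 1) * u ≤ (exp u - 1) * x := by
  have h := convexOn_exp.2 (Set.mem_univ 0) (Set.mem_univ u)
    (sub_nonneg.2 ((div_le_one hu).2 hxu)) (div_nonneg hx hu.le) (by ring)
  simp only [smul_eq_mul, mul_zero, exp_zero, zero_add, div_mul_cancel₀ _ hu.ne'] at h
  have h2 := mul_le_mul_of_nonneg_right h hu.le
  have h3 : ((1 - x / u) * 1 + x / u * exp u) * u = u - x + x * exp u := by field_simp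
  rw [h3] at h2
  linarith

/-- The choice of the exponential parameter `t / (μ + t / 3)` that turns a Bennett-type bound into
Bernstein's. -/
theorem bernstein_exponent_le {μ t : ℝ} (hμ : 0 < μ) (ht : 0 < t) :
    μ * (exp (t / (μ + t / 3)) - 1 - t / (μ + t / 3)) - t / (μ + t / 3) * t ≤
      -(t ^ 2 / (2 * (μ + t / 3))) := by
  have hb : 0 < μ + t / 3 := by positivity
  have h3 : t / (μ + t / 3) < 3 := by rw [div_lt_iff₀ hb]; linarith
  have h := mul_le_mul_of_nonneg_left (exp_sub_one_sub_le (by positivity) h3) hμ.le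
  have e : μ * ((t / (μ + t / 3)) ^ 2 / 2 / (1 - t / (μ + t / 3) / 3)) - t / (μ + t / 3) * t =
      -(t ^ 2 / (2 * (μ + t / 3))) := by
    have h1 : 1 - t / (μ + t / 3) / 3 = μ / (μ + t / 3) := by field_simp; ring
    rw [h1]; field_simp; ring
  linarith

end Real

/-- The exponential of a multiple of an idempotent. -/
theorem NormedSpace.exp_smul_of_mul_self {𝔸 : Type*} [NormedRing 𝔸] [NormedAlgebra ℝ 𝔸]
    [CompleteSpace 𝔸] (θ : ℝ) {Y : 𝔸} {r : ℝ} (hr : r ≠ 0) (hY : Y * Y = r • Y) :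
    NormedSpace.exp (θ • Y) = 1 + ((Real.exp (θ * r) - 1) / r) • Y := by
  have hpow : ∀ n : ℕ, Y ^ (n + 1) = r ^ n • Y := fun n => by
    induction n with
    | zero => simp
    | succ n ih => rw [pow_succ, ih, smul_mul_assoc, hY, smul_smul, pow_succ]
  have h1 : HasSum (fun n : ℕ => ((θ * r) ^ n / (n.factorial : ℝ))) (Real.exp (θ * r)) := by
    rw [Real.exp_eq_exp_ℝ]; exact NormedSpace.expSeries_div_hasSum_exp (θ * r)
  have h2 := (h1.smul_const (r⁻¹ • Y)).add (hasSum_ite_eq (0 : ℕ) (1 - r⁻¹ • Y))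
  have h3 := NormedSpace.exp_series_hasSum_exp' (𝕂 := ℝ) (θ • Y)
  have h4 : ∀ n : ℕ, ((n.factorial : ℝ)⁻¹) • (θ • Y) ^ n =
      ((θ * r) ^ n / (n.factorial : ℝ)) • (r⁻¹ • Y) + if n = 0 then 1 - r⁻¹ • Y else 0 := by
    intro n
    cases n with
    | zero => simp
    | succ n =>
      rw [smul_pow, hpow, if_neg (Nat.succ_ne_zero n), add_zero, smul_smul, smul_smul, smul_smul]
      congr 1
      field_simp
      ring
  have h5 := h3.unique (by simpa only [h4] using h2)
  rw [h5, div_eq_mul_inv, mul_smul, sub_smul, one_smul]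
  abel

/-! ### A scalar Bernstein inequality for finite product weights -/

section Bernstein

variable {Ω : Type*} [Fintype Ω]

open Classical in
/-- Markov's inequality for a finite weighted sum. -/
theorem Finset.sum_filter_le_sum_mul {α : Type*} [Fintype α] {P : α → Prop} {w f : α → ℝ}
    (hw : ∀ a, 0 ≤ w a) (hf : ∀ a, 0 ≤ f a) (h : ∀ a, P a → 1 ≤ f a) :
    ∑ a with P a, w a ≤ ∑ a, w a * f a := by
  rw [Finset.sum_filter]
  refine Finset.sum_le_sum fun a _ => ?_
  split_ifs with ha
  · exact le_mul_of_one_le_right (hw a) (h a ha)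
  · exact mul_nonneg (hw a) (hf a)

open Classical in
/-- The lower tail in Bernstein's inequality, for a variable that is bounded below by `-R` and
whose second moment is at most `R` times its mean. -/
theorem sum_prod_filter_sum_le_le {ρ X : Ω → ℝ} (hρ : ∀ ω, 0 ≤ ρ ω) (hρ1 : ∑ ω, ρ ω = 1)
    {R m t : ℝ} (hR : 0 < R) (hm : 0 < m) (ht : 0 < t) (hX : ∀ ω, -R ≤ X ω)
    (hmean : ∑ ω, ρ ω * X ω = m) (hsq : ∑ ω, ρ ω * X ω ^ 2 ≤ R * m) (n : ℕ) :
    ∑ s : Fin n → Ω with ∑ k, X (s k) ≤ n * (m - t), ∏ k, ρ (s k) ≤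
      Real.exp (-(n * (t ^ 2 / (2 * R * (m + t / 3))))) := by
  set u := t / (m + t / 3) with hu
  have hu0 : 0 < u := by positivity
  have hmgf : ∑ ω, ρ ω * Real.exp (-(u / R) * X ω) ≤
      Real.exp (m / R * (Real.exp u - 1 - u) - u * m / R) := by
    have h1 : ∀ ω, Real.exp (-(u / R) * X ω) ≤
        1 - u / R * X ω + (Real.exp u - 1 - u) / R ^ 2 * X ω ^ 2 := fun ω => by
      have hle : -(u / R) * X ω ≤ u := by
        have := mul_le_mul_of_nonneg_left (hX ω) (by positivity : 0 ≤ u / R)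
        have e : u / R * -R = -u := by field_simp
        linarith
      have h2 := Real.exp_sub_one_sub_mul_sq_le hu0 hle
      have e : (Real.exp u - 1 - u) * (-(u / R) * X ω) ^ 2 =
        ((Real.exp u - 1 - u) / R ^ 2 * X ω ^ 2) * u ^ 2 := by field_simp
      rw [e] at h2
      have := le_of_mul_le_mul_right h2 (by positivity)
      linarith
    have h2 : ∑ ω, ρ ω * Real.exp (-(u / R) * X ω) ≤
        1 - u / R * m + (Real.exp u - 1 - u) / R ^ 2 * (R * m) := by
      calc _ ≤ ∑ ω, (ρ ω - u / R * (ρ ω * X ω) +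
            (Real.exp u - 1 - u) / R ^ 2 * (ρ ω * X ω ^ 2)) :=
          Finset.sum_le_sum fun ω _ => by
            have := mul_le_mul_of_nonneg_left (h1 ω) (hρ ω)
            linarith
        _ = 1 - u / R * m + (Real.exp u - 1 - u) / R ^ 2 * ∑ ω, ρ ω * X ω ^ 2 := by
          rw [Finset.sum_add_distrib, Finset.sum_sub_distrib, ← Finset.mul_sum, ← Finset.mul_sum,
            hρ1, hmean]
        _ ≤ _ := by
          have : 0 ≤ Real.exp u - 1 - u := by linarith [Real.add_one_le_exp u]
          gcongr
    refine h2.trans ?_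
    have h3 := Real.add_one_le_exp (m / R * (Real.exp u - 1 - u) - u * m / R)
    refine le_trans (le_of_eq ?_) h3
    field_simp
    ring
  have hmgf0 : 0 ≤ ∑ ω, ρ ω * Real.exp (-(u / R) * X ω) :=
    Finset.sum_nonneg fun ω _ => mul_nonneg (hρ ω) (Real.exp_pos _).le
  calc _ ≤ ∑ s : Fin n → Ω, (∏ k, ρ (s k)) *
        Real.exp (u / R * (n * (m - t)) + ∑ k, -(u / R) * X (s k)) := by
        refine Finset.sum_filter_le_sum_mul (fun s => Finset.prod_nonneg fun k _ => hρ _)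
          (fun s => (Real.exp_pos _).le) fun s hs => Real.one_le_exp ?_
        rw [← Finset.mul_sum]
        have := mul_le_mul_of_nonneg_left hs (by positivity : 0 ≤ u / R)
        linarith
    _ = Real.exp (u / R * (n * (m - t))) * (∑ ω, ρ ω * Real.exp (-(u / R) * X ω)) ^ n := by
        rw [Fintype.sum_pow, Finset.mul_sum]
        refine Finset.sum_congr rfl fun s _ => ?_
        rw [Real.exp_add, Real.exp_sum, Finset.prod_mul_distrib]
        ring
    _ ≤ Real.exp (u / R * (n * (m - t))) *
          Real.exp (m / R * (Real.exp u - 1 - u) - u * m / R) ^ n := by gcongr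
    _ = Real.exp (n / R * (m * (Real.exp u - 1 - u) - u * t)) := by
        rw [← Real.exp_nat_mul, ← Real.exp_add]
        congr 1
        ring
    _ ≤ _ := by
        refine Real.exp_le_exp.2 ?_
        have h := mul_le_mul_of_nonneg_left (Real.bernstein_exponent_le hm ht)
          (by positivity : (0 : ℝ) ≤ n / R)
        refine h.trans (le_of_eq ?_)
        field_simp

end Bernstein

/-! ### A matrix Bernstein inequality for finite product weights -/

namespace Matrix

variable {ι : Type*} [Fintype ι] [DecidableEq ι]

open scoped MatrixOrder in
theorem PosSemidef.trace_mul_nonneg {A B : Matrix ι ι ℝ} (hA : A.PosSemidef)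
    (hB : B.PosSemidef) : 0 ≤ (A * B).trace := by
  obtain ⟨C, rfl⟩ := CStarAlgebra.nonneg_iff_eq_star_mul_self.mp hA.nonneg
  rw [mul_assoc, trace_mul_comm]
  exact (hB.mul_mul_conjTranspose_same C).trace_nonneg

theorem IsSymm.posSemidef_exp {A : Matrix ι ι ℝ} (hA : A.IsSymm) :
    (NormedSpace.exp A).PosSemidef := by
  have h : NormedSpace.exp A =
      (NormedSpace.exp ((2 : ℝ)⁻¹ • A))ᴴ * NormedSpace.exp ((2 : ℝ)⁻¹ • A) := by
    rw [conjTranspose_eq_transpose_of_trivial, (hA.smul _).exp.eq,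
      ← exp_add_of_commute _ _ (Commute.refl _), ← add_smul]
    norm_num
  rw [h]
  exact posSemidef_conjTranspose_mul_self _

open Unitary in
theorem IsHermitian.exp_eq_conj {A : Matrix ι ι ℝ} (hA : A.IsHermitian) :
    NormedSpace.exp A = (hA.eigenvectorUnitary : Matrix ι ι ℝ) *
      diagonal (fun i => Real.exp (hA.eigenvalues i)) *
        star (hA.eigenvectorUnitary : Matrix ι ι ℝ) := by
  set U := (hA.eigenvectorUnitary : Matrix ι ι ℝ) with hU
  have h1 : star U * U = 1 := Unitary.coe_star_mul_self _
  have hinv : U⁻¹ = star U := inv_eq_left_inv h1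
  have hu : IsUnit U := (isUnit_iff_isUnit_det _).2 (isUnit_det_of_left_inverse h1)
  have h2 : A = U * diagonal hA.eigenvalues * U⁻¹ := by
    conv_lhs => rw [hA.spectral_theorem, conjStarAlgAut_apply]
    rw [hinv]
    rfl
  conv_lhs => rw [h2]
  rw [exp_conj _ _ hu, exp_diagonal, hinv]
  congr 3
  ext i
  rw [Pi.coe_exp, Real.exp_eq_exp_ℝ]

theorem trace_exp_eq_sum_exp_eigenvalues {A : Matrix ι ι ℝ} (hA : A.IsHermitian) :
    (NormedSpace.exp A).trace = ∑ i, Real.exp (hA.eigenvalues i) := by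
  rw [hA.exp_eq_conj, trace_mul_comm, ← mul_assoc, Unitary.coe_star_mul_self, one_mul,
    trace_diagonal]

/-- If the quadratic form of `A` reaches `c * ‖x‖ ^ 2`, then some eigenvalue of `A` is at least `c`,
and so is the trace of `exp A` at least `exp c`. -/
theorem exp_le_trace_exp {A : Matrix ι ι ℝ} (hA : A.IsHermitian) {c : ℝ} {x : ι → ℝ} (hx : x ≠ 0)
    (h : c * (x ⬝ᵥ x) ≤ x ⬝ᵥ (A *ᵥ x)) : Real.exp c ≤ (NormedSpace.exp A).trace := by
  have hex : ∃ i, c ≤ hA.eigenvalues i := by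
    by_contra! hlt
    set U := (hA.eigenvectorUnitary : Matrix ι ι ℝ) with hU
    have h1 : U * star U = 1 := Unitary.coe_mul_star_self _
    have h2 : A = U * diagonal hA.eigenvalues * star U := by
      conv_lhs => rw [hA.spectral_theorem, Unitary.conjStarAlgAut_apply]
      rfl
    set z := star U *ᵥ x with hz
    have hstar : star U = Uᵀ := conjTranspose_eq_transpose_of_trivial U
    have hUz : U *ᵥ z = x := by rw [hz, mulVec_mulVec, h1, one_mulVec]
    have hxz : x ᵥ* U = z := by rw [hz, hstar, mulVec_transpose]
    have e1 : x ⬝ᵥ (A *ᵥ x) = ∑ i, hA.eigenvalues i * z i ^ 2 := by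
      have e0 : A *ᵥ x = U *ᵥ (diagonal hA.eigenvalues *ᵥ z) := by
        conv_lhs => rw [h2]
        rw [← mulVec_mulVec, ← hz, ← mulVec_mulVec]
      rw [e0, dotProduct_mulVec, hxz]
      simp only [dotProduct, mulVec_diagonal]
      exact Finset.sum_congr rfl fun i _ => by ring
    have e2 : x ⬝ᵥ x = ∑ i, z i ^ 2 := by
      conv_lhs => rw [← hUz]
      rw [dotProduct_mulVec, hUz, hxz]
      exact Finset.sum_congr rfl fun i _ => by ring
    have hz0 : z ≠ 0 := fun h0 => hx (by rw [← hUz, h0, mulVec_zero])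
    obtain ⟨i, hi⟩ := Function.ne_iff.1 hz0
    rw [e1, e2, Finset.mul_sum] at h
    refine absurd h (not_le.2 (Finset.sum_lt_sum (fun j _ => ?_) ⟨i, Finset.mem_univ i, ?_⟩))
    · exact mul_le_mul_of_nonneg_right (hlt j).le (sq_nonneg _)
    · exact mul_lt_mul_of_pos_right (hlt i) (by have : z i ≠ 0 := hi; positivity)
  obtain ⟨i, hi⟩ := hex
  rw [trace_exp_eq_sum_exp_eigenvalues hA]
  exact (Real.exp_le_exp.2 hi).trans
    (Finset.single_le_sum (f := fun j => Real.exp (hA.eigenvalues j))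
      (fun j _ => (Real.exp_pos _).le) (Finset.mem_univ i))

/-- The exponential of a rank-one matrix. -/
theorem exp_smul_vecMulVec_self (θ : ℝ) {y : ι → ℝ} (hy : y ⬝ᵥ y ≠ 0) :
    NormedSpace.exp (θ • vecMulVec y y) =
      1 + ((Real.exp (θ * (y ⬝ᵥ y)) - 1) / (y ⬝ᵥ y)) • vecMulVec y y := by
  let _ : NormedRing (Matrix ι ι ℝ) := Matrix.linftyOpNormedRing
  let _ : NormedAlgebra ℝ (Matrix ι ι ℝ) := Matrix.linftyOpNormedAlgebra
  exact NormedSpace.exp_smul_of_mul_self θ hy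
    (by rw [vecMulVec_mul_vecMulVec, vecMulVec_smul])

/-- The matrix moment generating function of a sum of independent terms factorizes up to the
Golden–Thompson inequality. -/
theorem sum_prod_mul_trace_exp_le {Ω : Type*} [Fintype Ω] {ρ : Ω → ℝ} (hρ : ∀ ω, 0 ≤ ρ ω)
    {Y : Ω → Matrix ι ι ℝ} (hY : ∀ ω, (Y ω).IsSymm) {κ : ℝ} (hκ : 0 ≤ κ)
    (h : (κ • (1 : Matrix ι ι ℝ) - ∑ ω, ρ ω • NormedSpace.exp (Y ω)).PosSemidef) (n : ℕ) :
    ∀ H : Matrix ι ι ℝ, H.IsSymm → ∑ s : Fin n → Ω, (∏ k, ρ (s k)) *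
      (NormedSpace.exp (H + ∑ k, Y (s k))).trace ≤ κ ^ n * (NormedSpace.exp H).trace := by
  induction n with
  | zero => intro H _; simp
  | succ n ih =>
    intro H hH
    rw [← (Fin.consEquiv fun _ => Ω).sum_comp, Fintype.sum_prod_type]
    simp only [Fin.consEquiv_apply, Fin.prod_univ_succ, Fin.sum_univ_succ, Fin.cons_zero,
      Fin.cons_succ, ← add_assoc, mul_assoc, ← Finset.mul_sum]
    calc _ ≤ ∑ ω, ρ ω * (κ ^ n * (NormedSpace.exp (H + Y ω)).trace) :=
          Finset.sum_le_sum fun ω _ => mul_le_mul_of_nonneg_left (ih _ (hH.add (hY ω))) (hρ ω)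
      _ ≤ ∑ ω, ρ ω * (κ ^ n * (NormedSpace.exp H * NormedSpace.exp (Y ω)).trace) :=
          Finset.sum_le_sum fun ω _ => mul_le_mul_of_nonneg_left
            (mul_le_mul_of_nonneg_left (trace_exp_add_le hH (hY ω)) (by positivity)) (hρ ω)
      _ = κ ^ n * (NormedSpace.exp H * ∑ ω, ρ ω • NormedSpace.exp (Y ω)).trace := by
          rw [Finset.mul_sum, trace_sum, Finset.mul_sum]
          refine Finset.sum_congr rfl fun ω _ => ?_
          rw [mul_smul_comm, trace_smul, smul_eq_mul]
          ring
      _ ≤ κ ^ n * (κ * (NormedSpace.exp H).trace) := by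
          have h1 := hH.posSemidef_exp.trace_mul_nonneg h
          rw [mul_sub, trace_sub, mul_smul_comm, mul_one, trace_smul, smul_eq_mul] at h1
          gcongr
          linarith
      _ = _ := by ring

open Classical in
/-- A **matrix Bernstein inequality** for sums of independent rank-one matrices `y yᵀ` with
`‖y‖² ≤ R` and `𝔼 y yᵀ ≤ μ`. -/
theorem sum_prod_filter_quadratic_form_ge_le {Ω : Type*} [Fintype Ω] {ρ : Ω → ℝ}
    (hρ : ∀ ω, 0 ≤ ρ ω) (hρ1 : ∑ ω, ρ ω = 1) {y : Ω → ι → ℝ} {R μ t : ℝ} (hR : 0 < R)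
    (hμ : 0 < μ) (ht : 0 < t) (hy : ∀ ω, y ω ⬝ᵥ y ω ≤ R)
    (hcov : (μ • (1 : Matrix ι ι ℝ) - ∑ ω, ρ ω • vecMulVec (y ω) (y ω)).PosSemidef) (n : ℕ) :
    ∑ s : Fin n → Ω with ∃ x : ι → ℝ, x ≠ 0 ∧
        n * (μ + t) * (x ⬝ᵥ x) ≤ ∑ k, (y (s k) ⬝ᵥ x) ^ 2, ∏ k, ρ (s k) ≤
      Fintype.card ι * Real.exp (-(n * (t ^ 2 / (2 * R * (μ + t / 3))))) := by
  set u := t / (μ + t / 3) with hu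
  have hu0 : 0 < u := by positivity
  have hsymm : ∀ z : ι → ℝ, (vecMulVec z z).IsSymm := fun z => by
    rw [IsSymm, transpose_vecMulVec]
  have hone : 0 ≤ Real.exp u - 1 := by linarith [Real.add_one_le_exp u]
  -- the chord bound for the exponential of a single rank-one term
  have hchord : ∀ ω, (1 + ((Real.exp u - 1) / R) • vecMulVec (y ω) (y ω) -
      NormedSpace.exp ((u / R) • vecMulVec (y ω) (y ω))).PosSemidef := fun ω => by
    have hps : (vecMulVec (y ω) (y ω)).PosSemidef := by
      simpa using posSemidef_vecMulVec_self_star (y ω)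
    by_cases h0 : y ω ⬝ᵥ y ω = 0
    · rw [dotProduct_self_eq_zero.1 h0]
      simp [PosSemidef.zero]
    · have hr : 0 < y ω ⬝ᵥ y ω :=
        lt_of_le_of_ne (by simpa using dotProduct_star_self_nonneg (y ω)) (Ne.symm h0)
      rw [exp_smul_vecMulVec_self _ h0, add_sub_add_left_eq_sub, ← sub_smul]
      refine hps.smul ?_
      rw [sub_nonneg, div_le_div_iff₀ hr hR]
      have h1 : u / R * (y ω ⬝ᵥ y ω) ≤ u := by
        calc _ ≤ u / R * R := by gcongr; exact hy ω
          _ = u := by field_simp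
      have h2 := Real.exp_sub_one_mul_le (by positivity) h1 hu0
      have e : (Real.exp u - 1) * (u / R * (y ω ⬝ᵥ y ω)) =
        (Real.exp u - 1) * (y ω ⬝ᵥ y ω) / R * u := by ring
      rw [e] at h2
      have h3 := le_of_mul_le_mul_right h2 hu0
      rwa [le_div_iff₀ hR] at h3
  set κ := Real.exp (μ / R * (Real.exp u - 1)) with hκ
  have hmgf : (κ • (1 : Matrix ι ι ℝ) -
      ∑ ω, ρ ω • NormedSpace.exp ((u / R) • vecMulVec (y ω) (y ω))).PosSemidef := by
    have e : κ • (1 : Matrix ι ι ℝ) -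
        ∑ ω, ρ ω • NormedSpace.exp ((u / R) • vecMulVec (y ω) (y ω)) =
        (κ - (1 + μ / R * (Real.exp u - 1))) • (1 : Matrix ι ι ℝ) +
        ((Real.exp u - 1) / R) • (μ • (1 : Matrix ι ι ℝ) - ∑ ω, ρ ω • vecMulVec (y ω) (y ω)) +
        ∑ ω, ρ ω • (1 + ((Real.exp u - 1) / R) • vecMulVec (y ω) (y ω) -
          NormedSpace.exp ((u / R) • vecMulVec (y ω) (y ω))) := by
      simp only [smul_sub, smul_add, Finset.sum_sub_distrib, Finset.sum_add_distrib,
        ← Finset.sum_smul, hρ1, one_smul, Finset.smul_sum, smul_smul, sub_smul, add_smul]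
      have e1 : ∀ ω, (Real.exp u - 1) / R * ρ ω = ρ ω * ((Real.exp u - 1) / R) := fun ω => by ring
      have e2 : (Real.exp u - 1) / R * μ = μ / R * (Real.exp u - 1) := by ring
      simp only [e1, e2]
      abel
    rw [e]
    refine ((PosSemidef.one.smul ?_).add (hcov.smul (by positivity))).add
      (posSemidef_sum _ fun ω _ => (hchord ω).smul (hρ ω))
    linarith [Real.add_one_le_exp (μ / R * (Real.exp u - 1))]
  have hmain := sum_prod_mul_trace_exp_le hρ
    (Y := fun ω => (u / R) • vecMulVec (y ω) (y ω)) (fun ω => (hsymm _).smul _)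
    (Real.exp_pos _).le hmgf n 0 isSymm_zero
  have hsum : ∀ s : Fin n → Ω,
      (0 + ∑ k, (u / R) • vecMulVec (y (s k)) (y (s k)) : Matrix ι ι ℝ).IsHermitian := fun s => by
    rw [zero_add, IsHermitian, conjTranspose_eq_transpose_of_trivial, transpose_sum]
    exact Finset.sum_congr rfl fun k _ => ((hsymm _).smul _).eq
  have htr : (NormedSpace.exp (0 : Matrix ι ι ℝ)).trace = Fintype.card ι := by
    rw [NormedSpace.exp_zero, trace_one]
  calc _ ≤ ∑ s : Fin n → Ω, (∏ k, ρ (s k)) * (Real.exp (-(u / R * (n * (μ + t)))) *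
        (NormedSpace.exp (0 + ∑ k, (u / R) • vecMulVec (y (s k)) (y (s k)))).trace) := by
        refine Finset.sum_filter_le_sum_mul (fun s => Finset.prod_nonneg fun k _ => hρ _)
          (fun s => mul_nonneg (Real.exp_pos _).le
            (IsSymm.posSemidef_exp (isHermitian_iff_isSymm.1 (hsum s))).trace_nonneg) fun s hs => ?_
        obtain ⟨x, hx, hxs⟩ := hs
        have h1 := exp_le_trace_exp (hsum s) hx (c := u / R * (n * (μ + t))) ?_
        · rw [Real.exp_neg, inv_mul_eq_div, one_le_div (Real.exp_pos _)]
          exact h1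
        · have e : x ⬝ᵥ ((0 + ∑ k, (u / R) • vecMulVec (y (s k)) (y (s k)) : Matrix ι ι ℝ) *ᵥ x) =
              u / R * ∑ k, (y (s k) ⬝ᵥ x) ^ 2 := by
            rw [zero_add, sum_mulVec, dotProduct_sum, Finset.mul_sum]
            refine Finset.sum_congr rfl fun k _ => ?_
            rw [smul_mulVec, vecMulVec_mulVec, dotProduct_smul, dotProduct_smul]
            rw [show x ⬝ᵥ y (s k) = y (s k) ⬝ᵥ x from dotProduct_comm _ _]
            simp [sq]
          rw [e, mul_assoc]
          gcongr
    _ = Real.exp (-(u / R * (n * (μ + t)))) * ∑ s : Fin n → Ω, (∏ k, ρ (s k)) *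
        (NormedSpace.exp (0 + ∑ k, (u / R) • vecMulVec (y (s k)) (y (s k)))).trace := by
        rw [Finset.mul_sum]
        exact Finset.sum_congr rfl fun s _ => by ring
    _ ≤ Real.exp (-(u / R * (n * (μ + t)))) * (κ ^ n * Fintype.card ι) := by
        rw [htr] at hmain
        gcongr
    _ = Fintype.card ι * Real.exp (n / R * (μ * (Real.exp u - 1 - u) - u * t)) := by
        rw [hκ, ← Real.exp_nat_mul, mul_comm _ (Fintype.card ι : ℝ), mul_left_comm, ← Real.exp_add]
        congr 2
        ring
    _ ≤ _ := by
        have h := mul_le_mul_of_nonneg_left (Real.bernstein_exponent_le hμ ht)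
          (by positivity : (0 : ℝ) ≤ n / R)
        gcongr
        refine h.trans (le_of_eq ?_)
        field_simp

end Matrix

/-! ### Moments of the Ising blockmodel -/

namespace IsingBlock

variable {p : ℕ}

theorem spin_mul_self (σ : Config p) (i : Fin p) : spin σ i * spin σ i = 1 := by
  rcases Int.units_eq_one_or (σ i) with h | h <;> simp [spin, h]

theorem abs_spin (σ : Config p) (i : Fin p) : |spin σ i| = 1 := by
  rcases Int.units_eq_one_or (σ i) with h | h <;> simp [spin, h]

theorem blockVec_mul_self (S : Finset (Fin p)) (i : Fin p) :
    blockVec S i * blockVec S i = 1 := by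
  unfold blockVec; split_ifs <;> norm_num

theorem abs_blockVec (S : Finset (Fin p)) (i : Fin p) : |blockVec S i| = 1 := by
  unfold blockVec; split_ifs <;> norm_num

theorem blockVec_mul_eq_ite (S : Finset (Fin p)) (i j : Fin p) :
    blockVec S i * blockVec S j = if SameBlock S i j then 1 else -1 := by
  unfold blockVec SameBlock
  by_cases hi : i ∈ S <;> by_cases hj : j ∈ S <;> simp [hi, hj]

theorem sum_blockVec (S : Finset (Fin p)) (hS : 2 * S.card = p) : ∑ i, blockVec S i = 0 := by
  have h1 : ∑ i, blockVec S i = ∑ i, (2 * (if i ∈ S then 1 else 0) - 1) :=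
    Finset.sum_congr rfl fun i _ => by unfold blockVec; split_ifs <;> norm_num
  have h2 : (2 : ℝ) * S.card = p := by exact_mod_cast hS
  rw [h1, Finset.sum_sub_distrib, ← Finset.mul_sum]
  simp [h2]

theorem blockVec_dotProduct_self (S : Finset (Fin p)) : blockVec S ⬝ᵥ blockVec S = p := by
  simp [dotProduct, blockVec_mul_self]

theorem spin_dotProduct_self (σ : Config p) : spin σ ⬝ᵥ spin σ = p := by
  simp [dotProduct, spin_mul_self]

/-- Expectation under the Ising blockmodel, as a finite sum. -/
noncomputable def mean (S : Finset (Fin p)) (α β : ℝ) (F : Config p → ℝ) : ℝ :=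
  ∑ σ, density S α β σ * F σ

section Mean

variable (S : Finset (Fin p)) (α β : ℝ)

theorem mean_const (c : ℝ) : mean S α β (fun _ => c) = c := by
  rw [mean, ← Finset.sum_mul, sum_density, one_mul]

theorem mean_add (F G : Config p → ℝ) :
    mean S α β (fun σ => F σ + G σ) = mean S α β F + mean S α β G := by
  simp only [mean, mul_add, Finset.sum_add_distrib]

theorem mean_sub (F G : Config p → ℝ) :
    mean S α β (fun σ => F σ - G σ) = mean S α β F - mean S α β G := by
  simp only [mean, mul_sub, Finset.sum_sub_distrib]

theorem mean_const_mul (c : ℝ) (F : Config p → ℝ) :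
    mean S α β (fun σ => c * F σ) = c * mean S α β F := by
  simp only [mean, Finset.mul_sum, mul_left_comm c]

theorem mean_sum {ι : Type*} (s : Finset ι) (F : ι → Config p → ℝ) :
    mean S α β (fun σ => ∑ k ∈ s, F k σ) = ∑ k ∈ s, mean S α β (F k) := by
  simp only [mean, Finset.mul_sum]
  exact Finset.sum_comm

theorem mean_mono {F G : Config p → ℝ} (h : ∀ σ, F σ ≤ G σ) : mean S α β F ≤ mean S α β G :=
  Finset.sum_le_sum fun σ _ => mul_le_mul_of_nonneg_left (h σ) (density_pos S α β σ).le

theorem mean_nonneg {F : Config p → ℝ} (h : ∀ σ, 0 ≤ F σ) : 0 ≤ mean S α β F :=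
  Finset.sum_nonneg fun σ _ => mul_nonneg (density_pos S α β σ).le (h σ)

theorem covMatrix_eq_mean (i j : Fin p) :
    covMatrix S α β i j = mean S α β fun σ => spin σ i * spin σ j := by
  rw [covMatrix, Matrix.of_apply, integral_law, mean]

/-- The covariance matrix is a combination of the identity, `𝟏𝟏ᵀ` and `v_S v_Sᵀ`. -/
theorem covMatrix_apply_eq (hS : 2 * S.card = p) (i j : Fin p) :
    covMatrix S α β i j = (1 - Delta S α β) * (if i = j then 1 else 0) +
      (Delta S α β + Omega S α β) / 2 +
      (Delta S α β - Omega S α β) / 2 * (blockVec S i * blockVec S j) := by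
  rw [blockVec_mul_eq_ite]
  by_cases hij : i = j
  · subst hij
    have h : SameBlock S i i := Iff.rfl
    rw [covMatrix_eq_mean]
    simp only [spin_mul_self, mean_const, if_pos h, if_true]
    ring
  · by_cases h : SameBlock S i j
    · rw [covMatrix_within S hS α β hij h, if_neg hij, if_pos h]; ring
    · rw [covMatrix_across S α β h, if_neg hij, if_neg h]; ring

/-- The second moments of linear statistics. -/
theorem mean_dotProduct_mul_dotProduct (hS : 2 * S.card = p) (x y : Fin p → ℝ) :
    mean S α β (fun σ => (spin σ ⬝ᵥ x) * (spin σ ⬝ᵥ y)) =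
      (1 - Delta S α β) * (x ⬝ᵥ y) +
      (Delta S α β + Omega S α β) / 2 * ((∑ i, x i) * ∑ i, y i) +
      (Delta S α β - Omega S α β) / 2 * ((blockVec S ⬝ᵥ x) * (blockVec S ⬝ᵥ y)) := by
  have h1 : ∀ σ : Config p, (spin σ ⬝ᵥ x) * (spin σ ⬝ᵥ y) =
      ∑ i, ∑ j, (x i * y j) * (spin σ i * spin σ j) := fun σ => by
    rw [dotProduct, dotProduct, Finset.sum_mul_sum]
    exact Finset.sum_congr rfl fun i _ => Finset.sum_congr rfl fun j _ => by ring
  simp only [h1, mean_sum, mean_const_mul, ← covMatrix_eq_mean, covMatrix_apply_eq S α β hS,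
    mul_add, Finset.sum_add_distrib]
  congr 1
  · congr 1
    · rw [dotProduct, Finset.mul_sum]
      refine Finset.sum_congr rfl fun i _ => ?_
      simp
      ring
    · rw [Finset.sum_mul_sum, Finset.mul_sum]
      refine Finset.sum_congr rfl fun i _ => ?_
      rw [Finset.mul_sum]
      exact Finset.sum_congr rfl fun j _ => by ring
  · rw [dotProduct, dotProduct, Finset.sum_mul_sum, Finset.mul_sum]
    refine Finset.sum_congr rfl fun i _ => ?_
    rw [Finset.mul_sum]
    exact Finset.sum_congr rfl fun j _ => by ring

/-- The exponent depends on the configuration through `∑ σ_i` and `v_S ⬝ σ` only. -/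
theorem exponent_eq (σ : Config p) : exponent S α β σ =
    (β + α) / (4 * p) * (∑ i, spin σ i) ^ 2 + (β - α) / (4 * p) * (spin σ ⬝ᵥ blockVec S) ^ 2 := by
  have h1 : (∑ x : Fin p × Fin p with SameBlock S x.1 x.2, spin σ x.1 * spin σ x.2) +
      (∑ x : Fin p × Fin p with ¬ SameBlock S x.1 x.2, spin σ x.1 * spin σ x.2) =
      (∑ i, spin σ i) ^ 2 := by
    rw [Finset.sum_filter_add_sum_filter_not, sq, Finset.sum_mul_sum, Fintype.sum_prod_type]
  have h2 : (∑ x : Fin p × Fin p with SameBlock S x.1 x.2, spin σ x.1 * spin σ x.2) -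
      (∑ x : Fin p × Fin p with ¬ SameBlock S x.1 x.2, spin σ x.1 * spin σ x.2) =
      (spin σ ⬝ᵥ blockVec S) ^ 2 := by
    rw [sq, dotProduct, Finset.sum_mul_sum, ← Fintype.sum_prod_type', Finset.sum_filter,
      Finset.sum_filter, ← Finset.sum_sub_distrib]
    refine Finset.sum_congr rfl fun x _ => ?_
    have h := blockVec_mul_eq_ite S x.1 x.2
    have e : spin σ x.1 * blockVec S x.1 * (spin σ x.2 * blockVec S x.2) =
      spin σ x.1 * spin σ x.2 * (blockVec S x.1 * blockVec S x.2) := by ring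
    rw [e, h]
    split_ifs <;> ring
  rw [← h1, ← h2, exponent]
  rcases eq_or_ne (p : ℝ) 0 with hp | hp
  · simp [hp]
  · field_simp
    ring

theorem density_eq_mul_exp (σ τ : Config p) :
    density S α β τ = density S α β σ * Real.exp (exponent S α β τ - exponent S α β σ) := by
  rw [density, density, Real.exp_sub]
  field_simp

/-- Relabelling the sites by a permutation: the spin of
`relabel e σ` at `k` is that of `σ` at `e k`. -/
def relabel (e : Equiv.Perm (Fin p)) : Equiv.Perm (Config p) := e.symm.arrowCongr (Equiv.refl _)

theorem spin_relabel (e : Equiv.Perm (Fin p)) (σ : Config p) (k : Fin p) :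
    spin (relabel e σ) k = spin σ (e k) := rfl

theorem spin_relabel_dotProduct_blockVec (e : Equiv.Perm (Fin p)) {c : ℝ} (hc : c * c = 1)
    (he : ∀ i, blockVec S (e i) = c * blockVec S i) (σ : Config p) :
    spin (relabel e σ) ⬝ᵥ blockVec S = c * (spin σ ⬝ᵥ blockVec S) := by
  rw [dotProduct, dotProduct, ← Equiv.sum_comp e (fun i => spin σ i * blockVec S i), Finset.mul_sum]
  refine Finset.sum_congr rfl fun i _ => ?_
  rw [spin_relabel, he]
  linear_combination (-(spin σ (e i) * blockVec S i)) * hc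

/-- Relabellings that map `v_S` to `± v_S` preserve expectations. -/
theorem mean_relabel (e : Equiv.Perm (Fin p)) {c : ℝ} (hc : c * c = 1)
    (he : ∀ i, blockVec S (e i) = c * blockVec S i) (F : Config p → ℝ) :
    mean S α β (fun σ => F (relabel e σ)) = mean S α β F := by
  refine Fintype.sum_equiv (relabel e) _ _ fun σ => ?_
  congr 1
  rw [density_eq_mul_exp S α β σ (relabel e σ)]
  have h1 : ∑ i, spin (relabel e σ) i = ∑ i, spin σ i := by
    simp only [spin_relabel]; exact Equiv.sum_comp e (spin σ)
  have h2 := spin_relabel_dotProduct_blockVec S e hc he σ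
  have h3 : exponent S α β (relabel e σ) = exponent S α β σ := by
    rw [exponent_eq, exponent_eq, h1, h2]
    linear_combination ((β - α) / (4 * p) * (spin σ ⬝ᵥ blockVec S) ^ 2) * hc
  rw [h3, sub_self, Real.exp_zero, mul_one]

/-- The relabellings preserving the partition `{S, Sᶜ}` act transitively on the sites. -/
theorem exists_perm_map_blockVec (hS : 2 * S.card = p) (i j : Fin p) :
    ∃ e : Equiv.Perm (Fin p), e i = j ∧
      ∃ c : ℝ, c * c = 1 ∧ ∀ k, blockVec S (e k) = c * blockVec S k := by
  have hswap : ∀ a b : Fin p, SameBlock S a b → ∀ k,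
      blockVec S (Equiv.swap a b k) = blockVec S k := fun a b h k => by
    simp only [blockVec, sameBlock_swap S h]
  by_cases h : SameBlock S i j
  · exact ⟨Equiv.swap i j, Equiv.swap_apply_left _ _, 1, by norm_num, fun k => by
      rw [hswap i j h, one_mul]⟩
  · obtain ⟨e, he⟩ := exists_exchange S hS
    have h' : SameBlock S (e i) j := by unfold SameBlock at *; rw [he]; tauto
    refine ⟨e.trans (Equiv.swap (e i) j), Equiv.swap_apply_left _ _, -1, by norm_num, fun k => ?_⟩
    rw [Equiv.trans_apply, hswap _ _ h']
    simp only [blockVec, he]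
    split_ifs <;> simp_all

end Mean

end IsingBlock

/-! ### A lower bound for `Δ - Ω` -/

namespace IsingBlock

variable {p : ℕ}

theorem abs_sum_spin_le (σ : Config p) : |∑ i, spin σ i| ≤ p := by
  refine (Finset.abs_sum_le_sum_abs _ _).trans (le_of_eq ?_)
  simp [abs_spin]

theorem abs_spin_dotProduct_blockVec_le (S : Finset (Fin p)) (σ : Config p) :
    |spin σ ⬝ᵥ blockVec S| ≤ p := by
  refine (Finset.abs_sum_le_sum_abs _ _).trans (le_of_eq ?_)
  simp [abs_mul, abs_spin, abs_blockVec]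

/-- Flipping the spin at the site `i`. -/
def flip (i : Fin p) (σ : Config p) : Config p := Function.update σ i (-σ i)

theorem spin_flip (i : Fin p) (σ : Config p) (k : Fin p) :
    spin (flip i σ) k = spin σ k - 2 * spin σ i * (if k = i then 1 else 0) := by
  by_cases h : k = i
  · subst h
    simp [spin, flip]
    ring
  · simp [spin, flip, h]

theorem flip_involutive (i : Fin p) : Function.Involutive (flip i) := fun σ => by
  simp [flip]

theorem spin_flip_dotProduct (i : Fin p) (σ : Config p) (x : Fin p → ℝ) :
    spin (flip i σ) ⬝ᵥ x = spin σ ⬝ᵥ x - 2 * spin σ i * x i := by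
  simp only [dotProduct, spin_flip, sub_mul, Finset.sum_sub_distrib]
  simp

theorem sum_spin_flip (i : Fin p) (σ : Config p) :
    ∑ k, spin (flip i σ) k = ∑ k, spin σ k - 2 * spin σ i := by
  simp only [spin_flip, Finset.sum_sub_distrib]
  simp

section

variable (S : Finset (Fin p)) (α β : ℝ)

/-- The exponent changes under a single spin flip by an amount that is bounded independently of the
number of sites. -/
theorem exponent_flip_ge (i : Fin p) (σ : Config p) :
    exponent S α β σ - 2 * (|β + α| + |β - α|) ≤ exponent S α β (flip i σ) := by
  have hp : (1 : ℝ) ≤ p := by exact_mod_cast (Nat.one_le_iff_ne_zero.2 (Fin.pos i).ne')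
  have key : ∀ c u a : ℝ, |u| ≤ (p : ℝ) → |a| = 1 →
      c / (4 * p) * u ^ 2 - 2 * |c| ≤ c / (4 * p) * (u - 2 * a) ^ 2 := by
    intro c u a hu ha
    have ha2 : a ^ 2 = 1 := by rw [← sq_abs, ha]; norm_num
    have h1 : |u ^ 2 - (u - 2 * a) ^ 2| ≤ (8 * p : ℝ) := by
      have e : u ^ 2 - (u - 2 * a) ^ 2 = 4 * (a * u) - 4 := by linear_combination (-4) * ha2
      have h2 : |a * u| ≤ (p : ℝ) := by rw [abs_mul, ha, one_mul]; exact hu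
      rw [e]
      rw [abs_le] at h2 ⊢
      constructor <;> linarith [h2.1, h2.2]
    have h2 : |c / (4 * p) * (u ^ 2 - (u - 2 * a) ^ 2)| ≤ 2 * |c| := by
      rw [abs_mul, abs_div, abs_of_pos (by positivity : (0 : ℝ) < 4 * p)]
      calc _ ≤ |c| / (4 * p) * (8 * p) := by gcongr
        _ = 2 * |c| := by field_simp; ring
    have := (abs_le.1 h2).2
    linarith
  rw [exponent_eq, exponent_eq, sum_spin_flip, spin_flip_dotProduct]
  have h1 := key (β + α) (∑ i, spin σ i) (spin σ i) (abs_sum_spin_le σ) (abs_spin σ i)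
  have h2 := key (β - α) (spin σ ⬝ᵥ blockVec S) (spin σ i * blockVec S i)
    (abs_spin_dotProduct_blockVec_le S σ) (by rw [abs_mul, abs_spin, abs_blockVec, one_mul])
  rw [mul_assoc 2 (spin σ i)]
  linarith

/-- A lower bound for the ratio of the densities of two configurations differing at one site. -/
noncomputable def flipRatio (α β : ℝ) : ℝ := Real.exp (-(2 * (|β + α| + |β - α|)))

theorem flipRatio_pos : 0 < flipRatio α β := Real.exp_pos _

theorem flipRatio_le_one : flipRatio α β ≤ 1 := Real.exp_le_one_iff.2 (by
  have := abs_nonneg (β + α); have := abs_nonneg (β - α); linarith)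

theorem flipRatio_mul_mean_le (i : Fin p) {F : Config p → ℝ} (hF : ∀ σ, 0 ≤ F σ) :
    flipRatio α β * mean S α β F ≤ mean S α β fun σ => F (flip i σ) := by
  have h : mean S α β (fun σ => F (flip i σ)) = ∑ σ, density S α β (flip i σ) * F σ := by
    refine Fintype.sum_equiv ((flip_involutive i).toPerm _) _ _ fun σ => ?_
    rw [Function.Involutive.coe_toPerm, flip_involutive i σ]
  rw [h, mean, Finset.mul_sum]
  refine Finset.sum_le_sum fun σ _ => ?_
  rw [← mul_assoc]
  refine mul_le_mul_of_nonneg_right ?_ (hF σ)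
  rw [density_eq_mul_exp S α β σ (flip i σ), mul_comm]
  refine mul_le_mul_of_nonneg_left (Real.exp_le_exp.2 ?_) (density_pos S α β σ).le
  linarith [exponent_flip_ge S α β i σ]

theorem exists_sameBlock_ne (hp : 4 ≤ p) (hS : 2 * S.card = p) :
    ∃ i j : Fin p, i ≠ j ∧ SameBlock S i j := by
  obtain ⟨i, hi, j, hj, hij⟩ := Finset.one_lt_card.1 (by omega : 1 < S.card)
  exact ⟨i, j, hij, by simp [SameBlock, hi, hj]⟩

theorem flipRatio_le_one_sub_Delta (hp : 4 ≤ p) (hS : 2 * S.card = p) :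
    flipRatio α β ≤ 1 - Delta S α β := by
  obtain ⟨i, j, hij, hb⟩ := exists_sameBlock_ne S hp hS
  have hbound : ∀ σ : Config p, 0 ≤ 1 + spin σ i * spin σ j := fun σ => by
    have h : |spin σ i * spin σ j| = 1 := by rw [abs_mul, abs_spin, abs_spin, one_mul]
    linarith [(abs_le.1 h.le).1]
  have h := flipRatio_mul_mean_le S α β i hbound
  have e : ∀ σ : Config p, 1 + spin (flip i σ) i * spin (flip i σ) j =
      1 - spin σ i * spin σ j := fun σ => by
    rw [spin_flip, spin_flip, if_pos rfl, if_neg hij.symm]; ring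
  simp only [e] at h
  rw [mean_add, mean_sub, mean_const, ← covMatrix_eq_mean, covMatrix_within S hS α β hij hb] at h
  have h0 := flipRatio_pos α β
  have h1 := flipRatio_le_one α β
  nlinarith

theorem mul_one_sub_exp_neg_ge {c x K : ℝ} (hc : 0 ≤ c) (hx : |x| ≤ K) :
    c * Real.exp (-(c * K)) * x ^ 2 ≤ x * (1 - Real.exp (-(c * x))) := by
  have hK : 0 ≤ K := (abs_nonneg x).trans hx
  rcases le_total 0 x with h | h
  · rw [abs_of_nonneg h] at hx
    have h1 : Real.exp (-(c * K)) ≤ Real.exp (-(c * x)) := Real.exp_le_exp.2 (by nlinarith)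
    have h2 := Real.add_one_le_exp (c * x)
    have h3 : Real.exp (-(c * x)) * Real.exp (c * x) = 1 := by rw [← Real.exp_add]; simp
    have h4 : Real.exp (-(c * x)) * (c * x) ≤ 1 - Real.exp (-(c * x)) := by
      nlinarith [Real.exp_pos (-(c * x))]
    calc c * Real.exp (-(c * K)) * x ^ 2 = x * (Real.exp (-(c * K)) * (c * x)) := by ring
      _ ≤ x * (Real.exp (-(c * x)) * (c * x)) := by gcongr
      _ ≤ _ := by gcongr
  · have h1 : Real.exp (-(c * K)) ≤ 1 := Real.exp_le_one_iff.2 (by nlinarith)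
    have h2 := Real.add_one_le_exp (-(c * x))
    calc c * Real.exp (-(c * K)) * x ^ 2 ≤ c * 1 * x ^ 2 := by gcongr
      _ = -x * (-(c * x)) := by ring
      _ ≤ -x * (Real.exp (-(c * x)) - 1) := by
          apply mul_le_mul_of_nonneg_left _ (by linarith); linarith
      _ = _ := by ring

/-- Exchanging the spins at two sites `i ∈ S` and `j ∉ S` tilts the density in favour of
`(σ_i - σ_j) * ∑_{k ≠ i, j} v_k σ_k > 0`, which makes `Δ - Ω` positive of order `1 / p`. -/
theorem Delta_sub_Omega_ge (hαβ : α < β) (hp : 4 ≤ p) (hS : 2 * S.card = p) :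
    (β - α) * Real.exp (-(4 * (β - α))) * flipRatio α β ^ 2 / p ≤
      Delta S α β - Omega S α β := by
  have hp' : (4 : ℝ) ≤ p := by exact_mod_cast hp
  have hq : 0 < β - α := sub_pos.2 hαβ
  obtain ⟨i, hi⟩ : S.Nonempty := Finset.card_pos.1 (by omega)
  obtain ⟨j, hj⟩ : Sᶜ.Nonempty := Finset.card_pos.1 (by
    rw [Finset.card_compl, Fintype.card_fin]; omega)
  rw [Finset.mem_compl] at hj
  have hij : i ≠ j := fun h => hj (h ▸ hi)
  have hvi : blockVec S i = 1 := by simp [blockVec, hi]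
  have hvj : blockVec S j = -1 := by simp [blockVec, hj]
  set y : Fin p → ℝ := Pi.single i 1 - Pi.single j 1 with hy
  set x : Fin p → ℝ := blockVec S - y with hx
  have hyi : y i = 1 := by simp [hy, hij]
  have hyj : y j = -1 := by simp [hy, hij.symm]
  have hxi : x i = 0 := by simp [hx, hyi, hvi]
  have hxj : x j = 0 := by simp [hx, hyj, hvj]
  have hdy : ∀ u : Fin p → ℝ, u ⬝ᵥ y = u i - u j := fun u => by
    simp [hy, dotProduct_sub]
  have hxy : x ⬝ᵥ y = 0 := by rw [hdy, hxi, hxj, sub_zero]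
  have hvy : blockVec S ⬝ᵥ y = 2 := by rw [hdy, hvi, hvj]; norm_num
  have hvx : blockVec S ⬝ᵥ x = p - 2 := by
    rw [hx, dotProduct_sub, hvy, blockVec_dotProduct_self]
  have hxx : x ⬝ᵥ x = p - 2 := by
    conv_lhs => enter [2]; rw [hx]
    rw [dotProduct_sub, hxy, dotProduct_comm, hvx, sub_zero]
  have hsy : ∑ k, y k = 0 := by simp [hy]
  have hsx : ∑ k, x k = 0 := by
    simp only [hx, Pi.sub_apply, Finset.sum_sub_distrib, hsy, sum_blockVec S hS, sub_zero]
  have hEx : mean S α β (fun σ => (spin σ ⬝ᵥ y) * (spin σ ⬝ᵥ x)) =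
      (Delta S α β - Omega S α β) * (p - 2) := by
    rw [mean_dotProduct_mul_dotProduct S α β hS, dotProduct_comm y x, hxy, hsy, hvy, hvx]
    ring
  have hExx : mean S α β (fun σ => (spin σ ⬝ᵥ x) ^ 2) = (1 - Delta S α β) * (p - 2) +
      (Delta S α β - Omega S α β) / 2 * (p - 2) ^ 2 := by
    simp only [sq]
    rw [mean_dotProduct_mul_dotProduct S α β hS, hxx, hsx, hvx]
    ring
  -- the second moment of the product, bounded below by flipping the spin at `i`
  have hflip : 2 * flipRatio α β * mean S α β (fun σ => (spin σ ⬝ᵥ x) ^ 2) ≤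
      mean S α β (fun σ => ((spin σ ⬝ᵥ y) * (spin σ ⬝ᵥ x)) ^ 2) := by
    have h1 := flipRatio_mul_mean_le S α β i
      (F := fun σ => (4 - (spin σ ⬝ᵥ y) ^ 2) * (spin σ ⬝ᵥ x) ^ 2) fun σ =>
        mul_nonneg (by
          rw [hdy]
          nlinarith [spin_mul_self σ i, spin_mul_self σ j,
            sq_nonneg (spin σ i + spin σ j)]) (sq_nonneg _)
    have e1 : ∀ σ : Config p, (4 - (spin (flip i σ) ⬝ᵥ y) ^ 2) * (spin (flip i σ) ⬝ᵥ x) ^ 2 =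
        ((spin σ ⬝ᵥ y) * (spin σ ⬝ᵥ x)) ^ 2 := fun σ => by
      rw [spin_flip_dotProduct, spin_flip_dotProduct, hxi, hyi, hdy]
      linear_combination (-2 * (spin σ ⬝ᵥ x) ^ 2) * (spin_mul_self σ i + spin_mul_self σ j)
    have e2 : ∀ σ : Config p, (4 - (spin σ ⬝ᵥ y) ^ 2) * (spin σ ⬝ᵥ x) ^ 2 =
        4 * (spin σ ⬝ᵥ x) ^ 2 - ((spin σ ⬝ᵥ y) * (spin σ ⬝ᵥ x)) ^ 2 := fun σ => by ring
    simp only [e1] at h1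
    simp only [e2] at h1
    rw [mean_sub, mean_const_mul] at h1
    have h0 := flipRatio_pos α β
    have h01 := flipRatio_le_one α β
    have h2 : 0 ≤ mean S α β (fun σ => ((spin σ ⬝ᵥ y) * (spin σ ⬝ᵥ x)) ^ 2) :=
      mean_nonneg S α β fun σ => sq_nonneg _
    nlinarith
  -- exchanging the spins at `i` and `j` changes the sign of the product
  have hswap : (β - α) / p * Real.exp (-(4 * (β - α))) *
      mean S α β (fun σ => ((spin σ ⬝ᵥ y) * (spin σ ⬝ᵥ x)) ^ 2) ≤
      2 * mean S α β (fun σ => (spin σ ⬝ᵥ y) * (spin σ ⬝ᵥ x)) := by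
    have hs1 : ∀ σ : Config p, spin (relabel (Equiv.swap i j) σ) ⬝ᵥ y = -(spin σ ⬝ᵥ y) :=
      fun σ => by
        rw [hdy, hdy, spin_relabel, spin_relabel, Equiv.swap_apply_left, Equiv.swap_apply_right]
        ring
    have hs2 : ∀ σ : Config p, spin (relabel (Equiv.swap i j) σ) ⬝ᵥ x = spin σ ⬝ᵥ x := fun σ => by
      rw [dotProduct, dotProduct, ← Equiv.sum_comp (Equiv.swap i j) (fun k => spin σ k * x k)]
      refine Finset.sum_congr rfl fun k _ => ?_
      rw [spin_relabel]
      by_cases h1 : k = i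
      · rw [h1, Equiv.swap_apply_left, hxi, hxj]
      · by_cases h2 : k = j
        · rw [h2, Equiv.swap_apply_right, hxi, hxj]
        · rw [Equiv.swap_apply_of_ne_of_ne h1 h2]
    have hv : ∀ σ : Config p, spin σ ⬝ᵥ blockVec S = spin σ ⬝ᵥ x + spin σ ⬝ᵥ y := fun σ => by
      rw [← dotProduct_add, hx, sub_add_cancel]
    have hdens : ∀ σ : Config p, density S α β (relabel (Equiv.swap i j) σ) =
        density S α β σ * Real.exp (-((β - α) / p * ((spin σ ⬝ᵥ y) * (spin σ ⬝ᵥ x)))) := fun σ => by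
      rw [density_eq_mul_exp S α β σ]
      congr 2
      have hsum : ∑ k, spin (relabel (Equiv.swap i j) σ) k = ∑ k, spin σ k := by
        simp only [spin_relabel]; exact Equiv.sum_comp _ (spin σ)
      rw [exponent_eq, exponent_eq, hsum, hv, hv, hs1, hs2]
      field_simp
      ring
    have h1 : mean S α β (fun σ => (spin σ ⬝ᵥ y) * (spin σ ⬝ᵥ x)) =
        ∑ σ, density S α β (relabel (Equiv.swap i j) σ) * -((spin σ ⬝ᵥ y) * (spin σ ⬝ᵥ x)) := by
      rw [mean, ← Equiv.sum_comp (relabel (Equiv.swap i j))]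
      refine Finset.sum_congr rfl fun σ _ => ?_
      rw [hs1, hs2, neg_mul]
    have h2 : 2 * mean S α β (fun σ => (spin σ ⬝ᵥ y) * (spin σ ⬝ᵥ x)) =
        mean S α β (fun σ => (spin σ ⬝ᵥ y) * (spin σ ⬝ᵥ x) *
          (1 - Real.exp (-((β - α) / p * ((spin σ ⬝ᵥ y) * (spin σ ⬝ᵥ x)))))) := by
      rw [two_mul]
      nth_rewrite 2 [h1]
      rw [mean, mean, ← Finset.sum_add_distrib]
      refine Finset.sum_congr rfl fun σ _ => ?_
      rw [hdens]
      ring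
    rw [h2, ← mean_const_mul]
    refine mean_mono S α β fun σ => ?_
    have hy2 : |spin σ ⬝ᵥ y| ≤ 2 := by
      rw [hdy]
      refine (abs_sub _ _).trans ?_
      rw [abs_spin, abs_spin]; norm_num
    have hx2 : |spin σ ⬝ᵥ x| ≤ 2 * p := by
      have e : spin σ ⬝ᵥ x = spin σ ⬝ᵥ blockVec S - spin σ ⬝ᵥ y := by rw [hv]; ring
      rw [e]
      refine (abs_sub _ _).trans ?_
      linarith [abs_spin_dotProduct_blockVec_le S σ]
    have h3 := mul_one_sub_exp_neg_ge (c := (β - α) / p) (K := 4 * p) (by positivity)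
      (x := (spin σ ⬝ᵥ y) * (spin σ ⬝ᵥ x)) (by
        rw [abs_mul]
        calc _ ≤ 2 * (2 * p : ℝ) := by gcongr
          _ = 4 * p := by ring)
    have e : (β - α) / p * (4 * p) = 4 * (β - α) := by field_simp
    rwa [e] at h3
  have hr := flipRatio_pos α β
  have hμ := flipRatio_le_one_sub_Delta S α β hp hS
  have hexp := Real.exp_pos (-(4 * (β - α)))
  rw [hEx] at hswap
  have hpos : 0 ≤ Delta S α β - Omega S α β := by
    have h0 : 0 ≤ mean S α β (fun σ => ((spin σ ⬝ᵥ y) * (spin σ ⬝ᵥ x)) ^ 2) :=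
      mean_nonneg S α β fun σ => sq_nonneg _
    have h1 : 0 ≤ 2 * ((Delta S α β - Omega S α β) * (p - 2)) := le_trans (by positivity) hswap
    by_contra! hneg
    nlinarith
  have hfin : (β - α) / p * Real.exp (-(4 * (β - α))) *
      (2 * flipRatio α β * (flipRatio α β * (p - 2))) ≤
      2 * ((Delta S α β - Omega S α β) * (p - 2)) := by
    refine le_trans (mul_le_mul_of_nonneg_left ?_ (by positivity)) hswap
    refine le_trans (mul_le_mul_of_nonneg_left ?_ (by positivity)) hflip
    rw [hExx]
    have h1 : flipRatio α β * (p - 2 : ℝ) ≤ (1 - Delta S α β) * (p - 2) :=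
      mul_le_mul_of_nonneg_right hμ (by linarith)
    have h2 : 0 ≤ (Delta S α β - Omega S α β) / 2 * ((p : ℝ) - 2) ^ 2 := by positivity
    linarith
  have e : (β - α) / p * Real.exp (-(4 * (β - α))) *
      (2 * flipRatio α β * (flipRatio α β * (p - 2))) =
      (β - α) * Real.exp (-(4 * (β - α))) * flipRatio α β ^ 2 / p * (2 * (p - 2 : ℝ)) := by
    field_simp
  rw [e, mul_left_comm 2] at hfin
  exact le_of_mul_le_mul_right hfin (by linarith)

end

end IsingBlock

/-! ### The dual certificate of the semidefinite program -/

namespace IsingBlock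

variable {p : ℕ}

theorem blockMatrix_apply (S : Finset (Fin p)) (i j : Fin p) :
    blockMatrix S i j = blockVec S i * blockVec S j := rfl

theorem blockMatrix_mem_elliptope (S : Finset (Fin p)) : blockMatrix S ∈ elliptope p := by
  refine ⟨?_, fun i => blockVec_mul_self S i⟩
  simpa [blockMatrix] using Matrix.posSemidef_vecMulVec_self_star (blockVec S)

theorem recoversBlocks_blockMatrix (S : Finset (Fin p)) : RecoversBlocks (blockMatrix S) S := by
  intro T
  constructor
  · intro h
    have hb : ∀ i j, SameBlock S i j ↔ SameBlock T i j := fun i j => by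
      have h1 := congr_fun₂ h i j
      rw [blockMatrix_apply, blockMatrix_apply, blockVec_mul_eq_ite, blockVec_mul_eq_ite] at h1
      split_ifs at h1 <;> first | tauto | norm_num at h1
    rcases isEmpty_or_nonempty (Fin p) with hp | ⟨⟨i₀⟩⟩
    · exact Or.inl (Subsingleton.elim _ _)
    · by_cases h0 : i₀ ∈ S ↔ i₀ ∈ T
      · refine Or.inl (Finset.ext fun j => ?_)
        have := hb i₀ j
        unfold SameBlock at this
        tauto
      · refine Or.inr (Finset.ext fun j => ?_)
        have := hb i₀ j
        rw [Finset.mem_compl]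
        unfold SameBlock at this
        tauto
  · rintro (rfl | rfl)
    · rfl
    · ext i j
      rw [blockMatrix_apply, blockMatrix_apply, blockVec_mul_eq_ite, blockVec_mul_eq_ite]
      exact if_congr (by simp only [SameBlock, Finset.mem_compl, not_iff_not]) rfl rfl

open scoped MatrixOrder in
/-- If `diag(v_i (A v)_i) - A` is positive definite on the orthogonal complement of `v = v_S`, then
`v vᵀ` is the unique maximizer of `Tr(A V)` over the elliptope: on the elliptope,
`Tr(A V)` equals the constant `∑ v_i (A v)_i` minus `Tr((diag(v_i (A v)_i) - A) V)`, and the latter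
vanishes only if every row of a square root of `V` is a multiple of `v`. -/
theorem unique_isSDPSolution_blockMatrix (S : Finset (Fin p)) {A : Matrix (Fin p) (Fin p) ℝ}
    (hA : A.IsSymm) (h : ∀ x : Fin p → ℝ, x ≠ 0 → x ⬝ᵥ blockVec S = 0 →
      x ⬝ᵥ A.mulVec x < ∑ i, blockVec S i * A.mulVec (blockVec S) i * x i ^ 2) :
    IsSDPSolution A (blockMatrix S) ∧ ∀ V, IsSDPSolution A V → V = blockMatrix S := by
  set v := blockVec S with hv
  set d : Fin p → ℝ := fun i => v i * A.mulVec v i with hd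
  set L : Matrix (Fin p) (Fin p) ℝ := Matrix.diagonal d - A with hL
  have hLx : ∀ x : Fin p → ℝ, x ⬝ᵥ L.mulVec x = ∑ i, d i * x i ^ 2 - x ⬝ᵥ A.mulVec x := fun x => by
    rw [hL, Matrix.sub_mulVec, dotProduct_sub]
    congr 1
    simp only [dotProduct, Matrix.mulVec_diagonal]
    exact Finset.sum_congr rfl fun i _ => by ring
  have hLs : L.IsSymm := (Matrix.isSymm_diagonal d).sub hA
  have hLv : L.mulVec v = 0 := by
    ext i
    have := blockVec_mul_self S i
    rw [← hv] at this
    simp only [hL, Matrix.sub_mulVec, Pi.sub_apply, Matrix.mulVec_diagonal, hd, Pi.zero_apply]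
    linear_combination (A.mulVec v i) * this
  have hvL : ∀ x, v ⬝ᵥ L.mulVec x = 0 := fun x => by
    rw [Matrix.dotProduct_mulVec, ← Matrix.mulVec_transpose, hLs.eq, hLv, zero_dotProduct]
  -- the quadratic form of `L` is nonnegative and vanishes on multiples of `v` only
  have hform : ∀ x : Fin p → ℝ, 0 ≤ x ⬝ᵥ L.mulVec x ∧
      (x ⬝ᵥ L.mulVec x = 0 → ∃ c : ℝ, x = c • v) := fun x => by
    set c := x ⬝ᵥ v / p with hc
    have hperp : (x - c • v) ⬝ᵥ v = 0 := by
      rw [sub_dotProduct, smul_dotProduct, hv, blockVec_dotProduct_self, ← hv, smul_eq_mul, hc]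
      rcases eq_or_ne (p : ℝ) 0 with hp | hp
      · have hp0 : p = 0 := by exact_mod_cast hp
        subst hp0
        simp
      · field_simp
        ring
    have hsame : x ⬝ᵥ L.mulVec x = (x - c • v) ⬝ᵥ L.mulVec (x - c • v) := by
      rw [Matrix.mulVec_sub, Matrix.mulVec_smul, hLv, smul_zero, sub_zero, sub_dotProduct,
        smul_dotProduct, hvL, smul_zero, sub_zero]
    by_cases h0 : x - c • v = 0
    · refine ⟨?_, fun _ => ⟨c, sub_eq_zero.1 h0⟩⟩
      rw [hsame, h0, zero_dotProduct]
    · have hpos := h _ h0 hperp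
      have h1 := hLx (x - c • v)
      rw [← hsame] at h1
      have h2 : 0 < x ⬝ᵥ L.mulVec x := by rw [h1]; exact sub_pos.2 hpos
      exact ⟨h2.le, fun h3 => absurd h3 h2.ne'⟩
  have htrA : ∀ W ∈ elliptope p, (A * W).trace = ∑ i, d i - (L * W).trace := fun W hW => by
    have h1 : (Matrix.diagonal d * W).trace = ∑ i, d i := by
      simp [Matrix.trace, Matrix.diagonal_mul, hW.2]
    rw [hL, Matrix.sub_mul, Matrix.trace_sub, h1]
    ring
  have htrL : ∀ B : Matrix (Fin p) (Fin p) ℝ,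
      (L * (star B * B)).trace = ∑ k, B.row k ⬝ᵥ L.mulVec (B.row k) := fun B => by
    rw [← mul_assoc, Matrix.trace_mul_comm, ← mul_assoc]
    refine Finset.sum_congr rfl fun k _ => ?_
    rw [Matrix.diag_apply, mul_assoc, Matrix.mul_apply]
    refine Finset.sum_congr rfl fun i _ => ?_
    rw [Matrix.mul_apply]
    rfl
  have hblock : (L * blockMatrix S).trace = 0 := by
    rw [blockMatrix, ← hv, Matrix.mul_vecMulVec, hLv]
    simp
  have hle : ∀ W ∈ elliptope p, 0 ≤ (L * W).trace ∧
      ((L * W).trace = 0 → W = blockMatrix S) := fun W hW => by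
    obtain ⟨B, hB⟩ := CStarAlgebra.nonneg_iff_eq_star_mul_self.mp hW.1.nonneg
    have htr := htrL B
    rw [← hB] at htr
    refine ⟨htr ▸ Finset.sum_nonneg fun k _ => (hform _).1, fun h0 => ?_⟩
    rw [htr, Finset.sum_eq_zero_iff_of_nonneg fun k _ => (hform _).1] at h0
    choose c hc using fun k => (hform (B.row k)).2 (h0 k (Finset.mem_univ k))
    have hW' : ∀ i j, W i j = (∑ k, c k ^ 2) * (v i * v j) := fun i j => by
      rw [hB, Matrix.mul_apply, Finset.sum_mul]
      refine Finset.sum_congr rfl fun k _ => ?_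
      have e1 : (star B) i k = B.row k i := rfl
      have e2 : B k j = B.row k j := rfl
      rw [e1, e2, hc k]
      simp only [Pi.smul_apply, smul_eq_mul]
      ring
    ext i j
    have h1 := hW.2 i
    rw [hW', hv, blockVec_mul_self, mul_one] at h1
    rw [hW', h1, one_mul, blockMatrix_apply]
  refine ⟨⟨blockMatrix_mem_elliptope S, fun W hW => ?_⟩, fun V hV => ?_⟩
  · rw [htrA W hW, htrA _ (blockMatrix_mem_elliptope S), hblock]
    linarith [(hle W hW).1]
  · have h1 := hV.2 _ (blockMatrix_mem_elliptope S)
    rw [htrA V hV.1, htrA _ (blockMatrix_mem_elliptope S), hblock] at h1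
    exact (hle V hV.1).2 (le_antisymm (by linarith) (hle V hV.1).1)

/-! ### Centered observations -/

/-- The projection `P σ` of a configuration off the all-ones vector. -/
noncomputable def centeredSpin (σ : Config p) (i : Fin p) : ℝ := spin σ i - (∑ k, spin σ k) / p

/-- The projection of `x` onto the orthogonal complement of the all-ones vector and `v_S`. -/
noncomputable def residual (S : Finset (Fin p)) (x : Fin p → ℝ) (i : Fin p) : ℝ :=
  x i - (∑ k, x k) / p - (x ⬝ᵥ blockVec S) / p * blockVec S i

theorem centering_mulVec_spin (σ : Config p) : (centering p).mulVec (spin σ) = centeredSpin σ := by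
  ext i
  rw [centering, Matrix.sub_mulVec, Matrix.one_mulVec, Matrix.smul_mulVec, Matrix.vecMulVec_mulVec]
  simp [centeredSpin, dotProduct]
  ring

theorem centeredEmpCov_eq {n : ℕ} (s : Fin n → Config p) : centeredEmpCov s =
    (1 / (n : ℝ)) • ∑ t, Matrix.vecMulVec (centeredSpin (s t)) (centeredSpin (s t)) := by
  have hs : (centering p).IsSymm := by
    rw [centering]
    refine Matrix.isSymm_one.sub (Matrix.IsSymm.smul ?_ _)
    rw [Matrix.IsSymm, Matrix.transpose_vecMulVec]
  rw [centeredEmpCov, empCov, mul_smul_comm, smul_mul_assoc, Finset.mul_sum, Finset.sum_mul]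
  congr 1
  refine Finset.sum_congr rfl fun t _ => ?_
  rw [Matrix.mul_vecMulVec, Matrix.vecMulVec_mul, ← Matrix.mulVec_transpose, hs.eq,
    centering_mulVec_spin]

theorem centeredEmpCov_isSymm {n : ℕ} (s : Fin n → Config p) : (centeredEmpCov s).IsSymm := by
  rw [centeredEmpCov_eq]
  refine Matrix.IsSymm.smul ?_ _
  rw [Matrix.IsSymm, Matrix.transpose_sum]
  simp only [Matrix.transpose_vecMulVec]

theorem centeredEmpCov_mulVec {n : ℕ} (s : Fin n → Config p) (x : Fin p → ℝ) (i : Fin p) :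
    (centeredEmpCov s).mulVec x i =
      1 / (n : ℝ) * ∑ t, centeredSpin (s t) i * (centeredSpin (s t) ⬝ᵥ x) := by
  rw [centeredEmpCov_eq, Matrix.smul_mulVec, Matrix.sum_mulVec, Pi.smul_apply, Finset.sum_apply,
    smul_eq_mul]
  congr 1
  refine Finset.sum_congr rfl fun t _ => ?_
  rw [Matrix.vecMulVec_mulVec]
  simp

theorem dotProduct_centeredEmpCov_mulVec {n : ℕ} (s : Fin n → Config p) (x : Fin p → ℝ) :
    x ⬝ᵥ (centeredEmpCov s).mulVec x = 1 / (n : ℝ) * ∑ t, (centeredSpin (s t) ⬝ᵥ x) ^ 2 := by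
  simp only [dotProduct, centeredEmpCov_mulVec]
  simp only [Finset.mul_sum]
  rw [Finset.sum_comm]
  refine Finset.sum_congr rfl fun t _ => ?_
  rw [sq, Finset.sum_mul_sum, Finset.mul_sum]
  refine Finset.sum_congr rfl fun i _ => ?_
  rw [Finset.mul_sum]
  exact Finset.sum_congr rfl fun j _ => by ring

theorem centeredSpin_dotProduct_blockVec (S : Finset (Fin p)) (hS : 2 * S.card = p)
    (σ : Config p) : centeredSpin σ ⬝ᵥ blockVec S = spin σ ⬝ᵥ blockVec S := by
  simp only [dotProduct, centeredSpin, sub_mul, Finset.sum_sub_distrib, ← Finset.mul_sum,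
    sum_blockVec S hS, mul_zero, sub_zero]

theorem residual_dotProduct (S : Finset (Fin p)) (x y : Fin p → ℝ) :
    residual S x ⬝ᵥ y = x ⬝ᵥ y - (∑ k, x k) * (∑ k, y k) / p -
      (x ⬝ᵥ blockVec S) * (y ⬝ᵥ blockVec S) / p := by
  have e : residual S x ⬝ᵥ y = x ⬝ᵥ y - (∑ k, x k) / p * ∑ k, y k -
      (x ⬝ᵥ blockVec S) / p * ∑ k, y k * blockVec S k := by
    simp only [dotProduct, residual, sub_mul, Finset.sum_sub_distrib, ← Finset.mul_sum, mul_assoc,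
      mul_comm (blockVec S _)]
  rw [e]
  simp only [dotProduct]
  ring

theorem sum_residual (S : Finset (Fin p)) (hS : 2 * S.card = p) (x : Fin p → ℝ) :
    ∑ k, residual S x k = 0 := by
  rcases eq_or_ne (p : ℝ) 0 with hp | hp
  · have hp0 : p = 0 := by exact_mod_cast hp
    subst hp0
    simp
  · simp only [residual, Finset.sum_sub_distrib, ← Finset.mul_sum, sum_blockVec S hS]
    simp
    field_simp
    ring

theorem residual_dotProduct_blockVec (S : Finset (Fin p)) (hS : 2 * S.card = p)
    (x : Fin p → ℝ) : residual S x ⬝ᵥ blockVec S = 0 := by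
  rw [residual_dotProduct, sum_blockVec S hS, blockVec_dotProduct_self]
  rcases eq_or_ne (p : ℝ) 0 with hp | hp
  · have hp0 : p = 0 := by exact_mod_cast hp
    subst hp0
    simp
  · field_simp
    ring

theorem residual_spin_dotProduct_of_perp (S : Finset (Fin p)) {x : Fin p → ℝ}
    (hx : x ⬝ᵥ blockVec S = 0) (σ : Config p) :
    residual S (spin σ) ⬝ᵥ x = centeredSpin σ ⬝ᵥ x := by
  rw [residual_dotProduct, hx]
  simp only [dotProduct, centeredSpin, sub_mul, Finset.sum_sub_distrib, ← Finset.mul_sum]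
  ring

/-- A deterministic criterion for exact recovery: the diagonal of the dual certificate dominates the
empirical second moments of the residual spins. -/
theorem exact_recovery_of_lt (S : Finset (Fin p)) (hS : 2 * S.card = p) {n : ℕ} (hn : 0 < n)
    (s : Fin n → Config p) {c : ℝ}
    (hdiag : ∀ i, n * c < ∑ t, blockVec S i * centeredSpin (s t) i * (spin (s t) ⬝ᵥ blockVec S))
    (hres : ∀ x : Fin p → ℝ, x ≠ 0 →
      ∑ t, (residual S (spin (s t)) ⬝ᵥ x) ^ 2 < n * c * (x ⬝ᵥ x)) :
    IsSDPSolution (centeredEmpCov s) (blockMatrix S) ∧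
      ∀ V, IsSDPSolution (centeredEmpCov s) V → V = blockMatrix S ∧ RecoversBlocks V S := by
  have hn' : (0 : ℝ) < n := by exact_mod_cast hn
  have key := unique_isSDPSolution_blockMatrix S (centeredEmpCov_isSymm s) fun x hx hxv => ?_
  · exact ⟨key.1, fun V hV => by
      rw [key.2 V hV]
      exact ⟨rfl, recoversBlocks_blockMatrix S⟩⟩
  · have h1 : x ⬝ᵥ (centeredEmpCov s).mulVec x < c * (x ⬝ᵥ x) := by
      rw [dotProduct_centeredEmpCov_mulVec, one_div, inv_mul_lt_iff₀ hn', ← mul_assoc]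
      simpa only [residual_spin_dotProduct_of_perp S hxv] using hres x hx
    refine h1.trans_le ?_
    rw [dotProduct, Finset.mul_sum]
    refine Finset.sum_le_sum fun i _ => ?_
    rw [← sq]
    refine mul_le_mul_of_nonneg_right ?_ (sq_nonneg _)
    rw [centeredEmpCov_mulVec, mul_left_comm, one_div, le_inv_mul_iff₀ hn']
    refine (hdiag i).le.trans (le_of_eq ?_)
    rw [Finset.mul_sum]
    refine Finset.sum_congr rfl fun t _ => ?_
    rw [centeredSpin_dotProduct_blockVec S hS, mul_assoc]

end IsingBlock

/-! ### Moments of the centered observations -/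

namespace IsingBlock

variable {p : ℕ} (S : Finset (Fin p)) (α β : ℝ)

theorem one_sub_Delta_le (hp : 4 ≤ p) (hS : 2 * S.card = p) :
    1 - Delta S α β ≤ 1 + 2 / (p - 2) := by
  have hp' : (4 : ℝ) ≤ p := by exact_mod_cast hp
  have h := mean_nonneg S α β (F := fun σ => (spin σ ⬝ᵥ (fun i => 1 + blockVec S i)) *
    (spin σ ⬝ᵥ (fun i => 1 + blockVec S i))) fun σ => mul_self_nonneg _
  have h1 : ∑ i, (1 + blockVec S i) = (p : ℝ) := by
    rw [Finset.sum_add_distrib, sum_blockVec S hS]; simp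
  have h2 : blockVec S ⬝ᵥ (fun i => 1 + blockVec S i) = (p : ℝ) := by
    simp only [dotProduct, mul_add, mul_one, blockVec_mul_self, Finset.sum_add_distrib,
      sum_blockVec S hS]
    simp
  have h3 : (fun i => 1 + blockVec S i) ⬝ᵥ (fun i => 1 + blockVec S i) = (2 * p : ℝ) := by
    have e : ∀ i, (1 + blockVec S i) * (1 + blockVec S i) = 2 * (1 + blockVec S i) := fun i => by
      linear_combination blockVec_mul_self S i
    simp only [dotProduct, e, ← Finset.mul_sum, h1]
  rw [mean_dotProduct_mul_dotProduct S α β hS, h1, h2, h3] at h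
  have h4 : 0 ≤ p * (2 + (p - 2) * Delta S α β) := by linarith
  have h5 := nonneg_of_mul_nonneg_right h4 (by linarith)
  have h6 : -Delta S α β ≤ 2 / (p - 2) := by
    rw [le_div_iff₀ (by linarith)]; linarith
  linarith

/-- `λ = 1 - Δ + p (Δ - Ω) / 2` is the mean of each diagonal entry of the dual certificate. -/
noncomputable def signal : ℝ := 1 - Delta S α β + p * (Delta S α β - Omega S α β) / 2

/-- The contribution of one observation to the `i`-th diagonal entry of the dual certificate. -/
noncomputable def diagStat (i : Fin p) (σ : Config p) : ℝ :=
  blockVec S i * centeredSpin σ i * (spin σ ⬝ᵥ blockVec S)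

theorem mean_diagStat (hS : 2 * S.card = p) (i : Fin p) :
    mean S α β (diagStat S i) = signal S α β := by
  set x : Fin p → ℝ := Pi.single i 1 - fun _ => 1 / (p : ℝ) with hx
  have hp : (p : ℝ) ≠ 0 := by exact_mod_cast (Fin.pos i).ne'
  have hxu : ∀ u : Fin p → ℝ, u ⬝ᵥ x = u i - (∑ k, u k) / p := fun u => by
    rw [hx, dotProduct_sub, dotProduct_single, mul_one]
    congr 1
    rw [dotProduct, ← Finset.sum_mul]
    ring
  have h1 : diagStat S i = fun σ =>
      blockVec S i * ((spin σ ⬝ᵥ x) * (spin σ ⬝ᵥ blockVec S)) := by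
    ext σ
    rw [diagStat, hxu, centeredSpin, mul_assoc]
  rw [h1, mean_const_mul, mean_dotProduct_mul_dotProduct S α β hS, dotProduct_comm x, hxu,
    sum_blockVec S hS, blockVec_dotProduct_self, signal]
  linear_combination (1 - Delta S α β + (Delta S α β - Omega S α β) / 2 * p) *
    blockVec_mul_self S i

theorem mean_sq_dotProduct_blockVec (hS : 2 * S.card = p) :
    mean S α β (fun σ => (spin σ ⬝ᵥ blockVec S) ^ 2) = p * signal S α β := by
  simp only [sq]
  rw [mean_dotProduct_mul_dotProduct S α β hS, sum_blockVec S hS, blockVec_dotProduct_self, signal]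
  ring

theorem sum_centeredSpin_sq_le (σ : Config p) : ∑ i, centeredSpin σ i ^ 2 ≤ p := by
  rcases eq_or_ne (p : ℝ) 0 with hp | hp
  · have hp0 : p = 0 := by exact_mod_cast hp
    subst hp0
    simp
  have e : ∀ i, centeredSpin σ i ^ 2 =
      1 - 2 * ((∑ k, spin σ k) / p) * spin σ i + ((∑ k, spin σ k) / p) ^ 2 := fun i => by
    rw [centeredSpin]
    linear_combination spin_mul_self σ i
  have h : ∑ i, centeredSpin σ i ^ 2 = p - (∑ k, spin σ k) ^ 2 / p := by
    simp only [e, Finset.sum_add_distrib, Finset.sum_sub_distrib, ← Finset.mul_sum]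
    simp
    field_simp
    ring
  rw [h]
  have : 0 ≤ (∑ k, spin σ k) ^ 2 / p := by positivity
  linarith

/-- By exchangeability of the sites, the second moment of `diagStat` can be averaged over the
sites. -/
theorem mean_diagStat_sq_le (hS : 2 * S.card = p) (i : Fin p) :
    mean S α β (fun σ => diagStat S i σ ^ 2) ≤ p * signal S α β := by
  have hp : (0 : ℝ) < p := by exact_mod_cast Fin.pos i
  have hsq : ∀ (j : Fin p) σ,
      diagStat S j σ ^ 2 = centeredSpin σ j ^ 2 * (spin σ ⬝ᵥ blockVec S) ^ 2 := fun j σ => by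
    rw [diagStat]
    linear_combination (centeredSpin σ j ^ 2 * (spin σ ⬝ᵥ blockVec S) ^ 2) *
      blockVec_mul_self S j
  have hconst : ∀ j, mean S α β (fun σ => diagStat S j σ ^ 2) =
      mean S α β (fun σ => diagStat S i σ ^ 2) := fun j => by
    obtain ⟨e, hij, c, hc, he⟩ := exists_perm_map_blockVec S hS i j
    rw [← mean_relabel S α β e hc he (fun σ => diagStat S i σ ^ 2)]
    congr 1
    ext σ
    have h1 : ∑ k, spin (relabel e σ) k = ∑ k, spin σ k := by
      simp only [spin_relabel]; exact Equiv.sum_comp e (spin σ)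
    have h2 : centeredSpin (relabel e σ) i = centeredSpin σ j := by
      rw [centeredSpin, centeredSpin, h1, spin_relabel, hij]
    rw [hsq, hsq, h2, spin_relabel_dotProduct_blockVec S e hc he]
    linear_combination (-(centeredSpin σ j ^ 2 * (spin σ ⬝ᵥ blockVec S) ^ 2)) * hc
  have hsum : ∑ j, mean S α β (fun σ => diagStat S j σ ^ 2) ≤ p * (p * signal S α β) := by
    rw [← mean_sum, ← mean_sq_dotProduct_blockVec S α β hS, ← mean_const_mul]
    refine mean_mono S α β fun σ => ?_
    simp only [hsq, ← Finset.sum_mul]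
    exact mul_le_mul_of_nonneg_right (sum_centeredSpin_sq_le σ) (sq_nonneg _)
  simp only [hconst, Finset.sum_const, Finset.card_univ, Fintype.card_fin, nsmul_eq_mul] at hsum
  exact le_of_mul_le_mul_left hsum hp

/-- The magnetizations of the two blocks lie in `[-p / 2, p / 2]`. -/
theorem abs_sum_add_abs_dotProduct_le (hS : 2 * S.card = p) (σ : Config p) :
    |∑ i, spin σ i| + |spin σ ⬝ᵥ blockVec S| ≤ p := by
  have key : ∀ c : ℝ, |c| = 1 → |∑ i, spin σ i + c * (spin σ ⬝ᵥ blockVec S)| ≤ p := fun c hc => by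
    have e : ∑ i, spin σ i + c * (spin σ ⬝ᵥ blockVec S) =
        ∑ i, spin σ i * (1 + c * blockVec S i) := by
      simp only [dotProduct, mul_add, mul_one, Finset.sum_add_distrib, Finset.mul_sum,
        mul_left_comm c]
    rw [e]
    refine (Finset.abs_sum_le_sum_abs _ _).trans (le_of_eq ?_)
    have h1 : ∀ i, |spin σ i * (1 + c * blockVec S i)| = 1 + c * blockVec S i := fun i => by
      have h2 : |c * blockVec S i| = 1 := by rw [abs_mul, hc, abs_blockVec, one_mul]
      rw [abs_mul, abs_spin, one_mul, abs_of_nonneg]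
      linarith [(abs_le.1 h2.le).1]
    simp only [h1, Finset.sum_add_distrib, ← Finset.mul_sum, sum_blockVec S hS]
    simp
  have h1 := key 1 (by norm_num)
  have h2 := key (-1) (by norm_num)
  rw [abs_le] at h1 h2
  rcases abs_cases (∑ i, spin σ i) with h3 | h3 <;>
    rcases abs_cases (spin σ ⬝ᵥ blockVec S) with h4 | h4 <;> linarith [h1.1, h1.2, h2.1, h2.2]

theorem neg_le_diagStat (hS : 2 * S.card = p) (i : Fin p) (σ : Config p) :
    -(p : ℝ) ≤ diagStat S i σ := by
  have hp : (0 : ℝ) < p := by exact_mod_cast Fin.pos i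
  refine (abs_le.1 ?_).1
  rw [diagStat, abs_mul, abs_mul, abs_blockVec, one_mul]
  have h1 : |centeredSpin σ i| ≤ 1 + |∑ k, spin σ k| / p := by
    rw [centeredSpin]
    refine (abs_sub _ _).trans (le_of_eq ?_)
    rw [abs_spin, abs_div, abs_of_pos hp]
  have h2 : |spin σ ⬝ᵥ blockVec S| ≤ p - |∑ k, spin σ k| := by
    linarith [abs_sum_add_abs_dotProduct_le S hS σ]
  calc _ ≤ (1 + |∑ k, spin σ k| / p) * (p - |∑ k, spin σ k|) := by gcongr
    _ = p - |∑ k, spin σ k| ^ 2 / p := by field_simp; ring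
    _ ≤ p := by
      have : 0 ≤ |∑ k, spin σ k| ^ 2 / p := by positivity
      linarith

theorem residual_dotProduct_self (hS : 2 * S.card = p) (x : Fin p → ℝ) :
    residual S x ⬝ᵥ residual S x =
      x ⬝ᵥ x - (∑ k, x k) ^ 2 / p - (x ⬝ᵥ blockVec S) ^ 2 / p := by
  have h1 := sum_residual S hS x
  have h2 := residual_dotProduct_blockVec S hS x
  rw [residual_dotProduct, h1, h2, dotProduct_comm, residual_dotProduct]
  ring

theorem residual_dotProduct_self_le (hS : 2 * S.card = p) (x : Fin p → ℝ) :
    residual S x ⬝ᵥ residual S x ≤ x ⬝ᵥ x := by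
  rw [residual_dotProduct_self S hS]
  have h1 : 0 ≤ (∑ k, x k) ^ 2 / p := by positivity
  have h2 : 0 ≤ (x ⬝ᵥ blockVec S) ^ 2 / p := by positivity
  linarith

theorem posSemidef_sub_cov_residual (hp : 4 ≤ p) (hS : 2 * S.card = p) :
    ((1 - Delta S α β) • (1 : Matrix (Fin p) (Fin p) ℝ) - ∑ σ, density S α β σ •
      Matrix.vecMulVec (residual S (spin σ)) (residual S (spin σ))).PosSemidef := by
  refine Matrix.PosSemidef.of_dotProduct_mulVec_nonneg ?_ fun x => ?_
  · rw [Matrix.IsHermitian, Matrix.conjTranspose_eq_transpose_of_trivial, Matrix.transpose_sub,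
      Matrix.transpose_smul, Matrix.transpose_one, Matrix.transpose_sum]
    simp only [Matrix.transpose_smul, Matrix.transpose_vecMulVec]
  · have h1 : x ⬝ᵥ (∑ σ, density S α β σ •
        Matrix.vecMulVec (residual S (spin σ)) (residual S (spin σ))).mulVec x =
        mean S α β (fun σ => (spin σ ⬝ᵥ residual S x) * (spin σ ⬝ᵥ residual S x)) := by
      rw [Matrix.sum_mulVec, dotProduct_sum, mean]
      refine Finset.sum_congr rfl fun σ _ => ?_
      have h2 : residual S (spin σ) ⬝ᵥ x = spin σ ⬝ᵥ residual S x := by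
        rw [dotProduct_comm (spin σ) (residual S x), residual_dotProduct, residual_dotProduct,
          dotProduct_comm x (spin σ)]
        ring
      rw [Matrix.smul_mulVec, Matrix.vecMulVec_mulVec, dotProduct_smul, dotProduct_smul, ← h2,
        dotProduct_comm x]
      simp
    have h0 : 0 ≤ 1 - Delta S α β :=
      (flipRatio_pos α β).le.trans (flipRatio_le_one_sub_Delta S α β hp hS)
    rw [star_trivial, Matrix.sub_mulVec, dotProduct_sub, h1,
      mean_dotProduct_mul_dotProduct S α β hS, sum_residual S hS, dotProduct_comm (blockVec S),
      residual_dotProduct_blockVec S hS, Matrix.smul_mulVec, Matrix.one_mulVec, dotProduct_smul,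
      smul_eq_mul]
    have := mul_le_mul_of_nonneg_left (residual_dotProduct_self_le S hS x) h0
    linarith

/-! ### Exact recovery with high probability -/

theorem law_real_singleton (σ : Config p) : (law S α β).real {σ} = density S α β σ := by
  rw [Measure.real, law, withDensity_apply _ (measurableSet_singleton σ),
    Measure.restrict_singleton]
  simp [(density_pos S α β σ).le]

instance (n : ℕ) : IsProbabilityMeasure (sampleLaw S α β n) := by
  unfold sampleLaw; infer_instance

open Classical in
theorem sampleLaw_real_setOf {n : ℕ} (P : (Fin n → Config p) → Prop) :
    (sampleLaw S α β n).real {s | P s} = ∑ s with P s, ∏ t, density S α β (s t) := by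
  have h1 : ∀ s : Fin n → Config p, (sampleLaw S α β n).real {s} = ∏ t, density S α β (s t) := by
    intro s
    rw [sampleLaw, Measure.real, Measure.pi_singleton, ENNReal.toReal_prod]
    exact Finset.prod_congr rfl fun t _ => law_real_singleton S α β (s t)
  have h2 : {s | P s} = ((Finset.univ.filter P : Finset (Fin n → Config p)) : Set _) := by
    ext; simp
  rw [h2, ← sum_measureReal_singleton]
  exact Finset.sum_congr rfl fun s _ => h1 s

/-- The failure probability of exact recovery. The diagonal of the dual certificate concentrates
around `λ`, the quadratic form of the residual spins around at most `1 - Δ`, and either is allowed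
half of the difference `p (Δ - Ω) / 2`. -/
theorem exact_recovery_prob_ge (hp : 4 ≤ p) (hS : 2 * S.card = p) {g : ℝ} (hg : 0 < g)
    (hgdef : g = p * (Delta S α β - Omega S α β) / 2) {n : ℕ} (hn : 0 < n) :
    1 - 2 * p * Real.exp (-(n * (g ^ 2 / (8 * p * (1 - Delta S α β + 7 / 6 * g))))) ≤
      (sampleLaw S α β n).real
        {s | IsSDPSolution (centeredEmpCov s) (blockMatrix S) ∧
          ∀ V, IsSDPSolution (centeredEmpCov s) V → V = blockMatrix S ∧ RecoversBlocks V S} := by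
  classical
  have hp0 : (0 : ℝ) < p := by exact_mod_cast (by omega : 0 < p)
  set μ := 1 - Delta S α β with hμdef
  have hμ : 0 < μ := (flipRatio_pos α β).trans_le (flipRatio_le_one_sub_Delta S α β hp hS)
  have hsig : signal S α β = μ + g := by rw [signal, hgdef]
  have hdiag : ∀ i, (sampleLaw S α β n).real
      {s | ∑ t, diagStat S i (s t) ≤ n * (μ + g - g / 2)} ≤
      Real.exp (-(n * (g ^ 2 / (8 * p * (μ + 7 / 6 * g))))) := fun i => by
    rw [sampleLaw_real_setOf]
    have h := sum_prod_filter_sum_le_le (fun σ => (density_pos S α β σ).le) (sum_density S α β)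
      hp0 (by positivity : 0 < μ + g) (half_pos hg) (neg_le_diagStat S hS i)
      (hsig ▸ mean_diagStat S α β hS i) (hsig ▸ mean_diagStat_sq_le S α β hS i) n
    refine h.trans (le_of_eq ?_)
    congr 3
    field_simp
    ring
  have hmat : (sampleLaw S α β n).real
      {s | ∃ x : Fin p → ℝ, x ≠ 0 ∧
        n * (μ + g / 2) * (x ⬝ᵥ x) ≤ ∑ t, (residual S (spin (s t)) ⬝ᵥ x) ^ 2} ≤
      p * Real.exp (-(n * (g ^ 2 / (8 * p * (μ + 7 / 6 * g))))) := by
    rw [sampleLaw_real_setOf]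
    have h := Matrix.sum_prod_filter_quadratic_form_ge_le (fun σ => (density_pos S α β σ).le)
      (sum_density S α β) (y := fun σ => residual S (spin σ)) hp0 hμ (half_pos hg)
      (fun σ => (residual_dotProduct_self_le S hS _).trans (spin_dotProduct_self σ).le)
      (posSemidef_sub_cov_residual S α β hp hS) n
    refine h.trans ?_
    have e : (g / 2) ^ 2 / (2 * p * (μ + g / 2 / 3)) = g ^ 2 / (8 * p * (μ + 1 / 6 * g)) := by
      field_simp
      ring
    rw [Fintype.card_fin, e]
    gcongr
    norm_num
  set K := Real.exp (-(n * (g ^ 2 / (8 * p * (μ + 7 / 6 * g))))) with hK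
  set good : Set (Fin n → Config p) :=
    {s | IsSDPSolution (centeredEmpCov s) (blockMatrix S) ∧
      ∀ V, IsSDPSolution (centeredEmpCov s) V → V = blockMatrix S ∧ RecoversBlocks V S} with hgood
  have hsub : goodᶜ ⊆ (⋃ i, {s | ∑ t, diagStat S i (s t) ≤ n * (μ + g - g / 2)}) ∪
      {s | ∃ x : Fin p → ℝ, x ≠ 0 ∧
        n * (μ + g / 2) * (x ⬝ᵥ x) ≤ ∑ t, (residual S (spin (s t)) ⬝ᵥ x) ^ 2} := by
    intro s hs
    by_contra hcon
    simp only [Set.mem_union, Set.mem_iUnion, Set.mem_ofPred_eq, not_or, not_exists, not_and,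
      not_le] at hcon
    refine hs (exact_recovery_of_lt S hS hn s (c := μ + g / 2) (fun i => ?_) hcon.2)
    have e : μ + g - g / 2 = μ + g / 2 := by ring
    exact e ▸ hcon.1 i
  have hbad : (sampleLaw S α β n).real goodᶜ ≤ 2 * p * K := by
    calc _ ≤ _ := measureReal_mono hsub
      _ ≤ _ := measureReal_union_le _ _
      _ ≤ ∑ _i : Fin p, K + p * K := by
          refine add_le_add ((measureReal_iUnion_fintype_le _).trans ?_) hmat
          exact Finset.sum_le_sum fun i _ => hdiag i
      _ = 2 * p * K := by simp; ring
  have hcompl := probReal_compl_eq_one_sub (μ := sampleLaw S α β n)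
    (Set.toFinite good).measurableSet
  linarith

end IsingBlock

/-! ### Exact recovery by the semidefinite program -/

theorem mainTheorem1 (α β : ℝ) (hαβ : α < β) :
    (∃ C : ℝ, 0 < C ∧ ∀ (p : ℕ) (S : Finset (Fin p)), 4 ≤ p → 2 * S.card = p →
      C / p < IsingBlock.Delta S α β - IsingBlock.Omega S α β) ∧
    ∀ C : ℝ, 0 < C →
      ∃ ε : ℕ → ℝ, Tendsto ε atTop (𝓝 0) ∧
        ∀ (p : ℕ) (S : Finset (Fin p)), 4 ≤ p → 2 * S.card = p →
          C / p < IsingBlock.Delta S α β - IsingBlock.Omega S α β →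
          ∀ (δ : ℝ) (n : ℕ), 0 < δ →
            16 * (3 + 2 / C) *
                (Real.log (4 * p / δ) / (IsingBlock.Delta S α β - IsingBlock.Omega S α β)) *
                (1 + ε p) < n →
            1 - δ ≤ (IsingBlock.sampleLaw S α β n).real
              {s | IsingBlock.IsSDPSolution (IsingBlock.centeredEmpCov s)
                    (IsingBlock.blockMatrix S) ∧
                  ∀ V, IsingBlock.IsSDPSolution (IsingBlock.centeredEmpCov s) V →
                    V = IsingBlock.blockMatrix S ∧ IsingBlock.RecoversBlocks V S} := by
  refine ⟨⟨(β - α) * Real.exp (-(4 * (β - α))) * IsingBlock.flipRatio α β ^ 2 / 2, ?_, ?_⟩, ?_⟩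
  · have := IsingBlock.flipRatio_pos α β
    have : 0 < β - α := sub_pos.2 hαβ
    positivity
  · intro p S hp hS
    have hp0 : (0 : ℝ) < p := by exact_mod_cast (by omega : 0 < p)
    refine lt_of_lt_of_le ?_ (IsingBlock.Delta_sub_Omega_ge S α β hαβ hp hS)
    have := IsingBlock.flipRatio_pos α β
    have : 0 < β - α := sub_pos.2 hαβ
    gcongr
    exact half_lt_self (by positivity)
  · intro C hC
    -- `1 + ε p` bounds `1 - Δ`, the only quantity in the sample size that is not explicit
    refine ⟨fun p => 2 / ((p : ℝ) - 2), ?_, ?_⟩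
    · exact Tendsto.const_div_atTop
        (tendsto_atTop_add_const_right _ _ tendsto_natCast_atTop_atTop) 2
    · intro p S hp hS hgap δ n hδ hn
      have hp4 : (4 : ℝ) ≤ p := by exact_mod_cast hp
      have hp0 : (0 : ℝ) < p := by linarith
      rcases le_or_gt 1 δ with hδ1 | hδ1
      · exact (sub_nonpos.2 hδ1).trans measureReal_nonneg
      have hlog : 0 < Real.log (4 * p / δ) := Real.log_pos (by
        rw [lt_div_iff₀ hδ]; linarith)
      set D := IsingBlock.Delta S α β - IsingBlock.Omega S α β with hD
      have hD0 : 0 < D := lt_trans (by positivity) hgap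
      set g : ℝ := p * D / 2 with hg
      have hg0 : 0 < g := by positivity
      have hCg : C < 2 * g := by
        rw [div_lt_iff₀ hp0] at hgap
        rw [hg]; linarith
      have hμ := IsingBlock.one_sub_Delta_le S α β hp hS
      have hμ0 : 0 < 1 - IsingBlock.Delta S α β := (IsingBlock.flipRatio_pos α β).trans_le
        (IsingBlock.flipRatio_le_one_sub_Delta S α β hp hS)
      set μ := 1 - IsingBlock.Delta S α β with hμdef
      have hε : 0 ≤ 2 / ((p : ℝ) - 2) := div_nonneg (by norm_num) (by linarith)
      set ε := 2 / ((p : ℝ) - 2)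
      have hC' : 1 / g ≤ 2 / C := by
        rw [div_le_div_iff₀ hg0 hC]; linarith
      have hfac : (μ + 7 / 6 * g) / g ≤ (3 + 2 / C) * (1 + ε) := by
        calc (μ + 7 / 6 * g) / g ≤ (1 + ε) * (1 / g) + 3 * 1 := by
              rw [add_div, mul_div_assoc, div_self hg0.ne', mul_one_div]
              gcongr
              norm_num
          _ ≤ (1 + ε) * (2 / C) + 3 * (1 + ε) := by
              gcongr
              linarith
          _ = _ := by ring
      have hsize : Real.log (4 * p / δ) ≤ n * (g ^ 2 / (8 * p * (μ + 7 / 6 * g))) := by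
        have h1 : 16 * ((μ + 7 / 6 * g) / g) * (Real.log (4 * p / δ) / D) ≤ n := by
          refine le_trans ?_ hn.le
          calc _ ≤ 16 * ((3 + 2 / C) * (1 + ε)) * (Real.log (4 * p / δ) / D) := by gcongr
            _ = _ := by ring
        have e : Real.log (4 * p / δ) =
            (16 * ((μ + 7 / 6 * g) / g) * (Real.log (4 * p / δ) / D)) *
              (g ^ 2 / (8 * p * (μ + 7 / 6 * g))) := by
          have hDg : D = 2 * g / p := by rw [hg]; field_simp
          rw [hDg]
          field_simp
          norm_num
        rw [e]
        gcongr
      have hn0 : 0 < n := by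
        rcases Nat.eq_zero_or_pos n with h | h
        · rw [h] at hsize; simp at hsize; linarith
        · exact h
      refine le_trans ?_ (IsingBlock.exact_recovery_prob_ge S α β hp hS hg0 rfl hn0)
      have hexp : Real.exp (-(n * (g ^ 2 / (8 * p * (μ + 7 / 6 * g))))) ≤ δ / (4 * p) := by
        refine (Real.exp_le_exp.2 (neg_le_neg hsize)).trans (le_of_eq ?_)
        rw [Real.exp_neg, Real.exp_log (by positivity), inv_div]
      have h2 : 2 * p * Real.exp (-(n * (g ^ 2 / (8 * p * (μ + 7 / 6 * g))))) ≤ δ := by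
        calc _ ≤ 2 * p * (δ / (4 * p)) := by gcongr
          _ = δ / 2 := by field_simp; norm_num
          _ ≤ δ := by linarith
      linarith
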